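/- Let $J$ be the Jacobi operator of a semi-infinite Jacobi matrix, that is, the closure in $\ell_2(\mathbb N)$ of the operator $(Jf)_1=q_1f_1+b_1f_2$, $(Jf)_k=b_{k-1}f_{k-1}+q_kf_k+b_kf_{k+1}$ ($k\ge 2$) on the finitely supported sequences, where $q_k\in\mathbb R$ and $b_k>0$. Let $P_0,P_1,\dots$ and $Q_0,Q_1,\dots$ be the polynomials of the first and second kind: for every $\zeta\in\mathbb C$ both $f_k=P_{k-1}(\zeta)$ and $f_k=Q_{k-1}(\zeta)$ satisfy $b_{k-1}f_{k-1}+q_kf_k+b_kf_{k+1}=\zeta f_k$ for $k\ge2$, with $P_0=1$, $P_1(\zeta)=(\zeta-q_1)/b_1$, $Q_0=0$, $Q_1=1/b_1$. For $g\in\mathbb R\cup\{+\infty\}$ put $v_k(g)=P_{k-1}(0)+gQ_{k-1}(0)$ if $g\in\mathbb R$ and $v_k(+\infty)=Q_{k-1}(0)$. If $J=J^*$, put $J(g)=J$ for every $g$; if $J\ne J^*$, let $J(g)$ be the self-adjoint restriction of $J^*$ to $$D(g)=\Bigl\{f\in\operatorname{dom}(J^*):\ \lim_{n\to\infty}b_n\bigl(v_n(g)f_{n+1}-f_nv_{n+1}(g)\bigr)=0\Bigr\}.$$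 For $h\in\mathbb R$ let $J_h(g)=J(g)-h\langle\cdot,e_1\rangle e_1$, where $e_1$ is the first vector of the canonical basis. Write $\sigma(T)$ for the spectrum of $T$; it is called discrete if it consists of eigenvalues of finite multiplicity and has no finite accumulation point. **Theorem.** Suppose that $J(g)$ has discrete spectrum and let $h_1\ne h_2$ be real numbers. Then $\sigma(J_{h_1}(g))$ and $\sigma(J_{h_2}(g))$, together with $h_1$ (respectively, $h_2$), uniquely determine the operator $J$ (equivalently, its matrix), the number $h_2$ (respectively, $h_1$) and, if $J\ne J^*$, the boundary condition $g$ at infinity. That is: let $J'$ be a Jacobi operator with matrix entries $q_k',b_k'$, and let $g'\in\mathbb R\cup\{+\infty\}$ and $h_1',h_2'\in\mathbb R$ be such that $\sigma(J_{h_1}(g))=\sigma(J'_{h_1'}(g'))$ and $\sigma(J_{h_2}(g))=\sigma(J'_{h_2'}(g'))$. If $h_1=h_1'$, then $q_k=q_k'$ and $b_k=b_k'$ for all $k$, $h_2=h_2'$, and, if $J\ne J^*$, $g=g'$. If $h_2=h_2'$, then $q_k=q_k'$ and $b_k=b_k'$ for all $k$, $h_1=h_1'$, and, if $J\ne J^*$,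 $g=g'$. -/

import Mathlib

open Filter Topology

noncomputable section

/-- The Hilbert space `ℓ²(ℕ)` of complex square-summable sequences. Sequences are indexed from `0`:
the entry `f k` of the code is the entry `f_{k+1}` of a sequence `f₁, f₂, f₃, …`. -/
abbrev EllTwo : Type := lp (fun _ : ℕ => ℂ) 2

/-- The first vector of the canonical basis. -/
def firstBasisVector : EllTwo := lp.single 2 0 (1 : ℂ)

/-- A semi-infinite Jacobi matrix: real diagonal entries `q 0, q 1, …` and positive off-diagonal
entries `b 0, b 1, …` (that is, `q₁, q₂, …` and `b₁, b₂, …` in one-based numbering). -/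
@[ext]
structure JacobiMatrix where
  q : ℕ → ℝ
  b : ℕ → ℝ
  b_pos : ∀ n, 0 < b n

namespace JacobiMatrix

variable (A : JacobiMatrix)

/-- The second order difference expression attached to the matrix, acting on all sequences. -/
def diffExpr (f : ℕ → ℂ) : ℕ → ℂ
  | 0 => (A.q 0 : ℂ) * f 0 + (A.b 0 : ℂ) * f 1
  | k + 1 => (A.b k : ℂ) * f k + (A.q (k + 1) : ℂ) * f (k + 1) + (A.b (k + 1) : ℂ) * f (k + 2)

theorem diffExpr_add (f g : ℕ → ℂ) : A.diffExpr (f + g) = A.diffExpr f + A.diffExpr g := by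
  funext k
  cases k <;> simp only [diffExpr, Pi.add_apply] <;> ring

theorem diffExpr_smul (c : ℂ) (f : ℕ → ℂ) : A.diffExpr (c • f) = c • A.diffExpr f := by
  funext k
  cases k <;> simp only [diffExpr, Pi.smul_apply, smul_eq_mul] <;> ring

end JacobiMatrix

/-- The subspace of the finitely supported sequences. -/
def finSeq : Submodule ℂ EllTwo where
  carrier := {f | (Function.support (f : ℕ → ℂ)).Finite}
  zero_mem' := by
    refine Set.finite_empty.subset fun k hk => ?_
    exact absurd rfl hk
  add_mem' := by
    intro f g hf hg
    exact (hf.union hg).subset (Function.support_add _ _)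
  smul_mem' := by
    intro c f hf
    exact hf.subset (Function.support_const_smul_subset c _)

namespace JacobiMatrix

variable (A : JacobiMatrix)

theorem diffExpr_memℓp {f : ℕ → ℂ} (hf : (Function.support f).Finite) :
    Memℓp (A.diffExpr f) 2 := by
  have h0 : Memℓp (A.diffExpr f) 0 := by
    refine memℓp_zero ?_
    obtain ⟨N, hN⟩ := hf.bddAbove
    have hz : ∀ m, N < m → f m = 0 := by
      intro m hm
      by_contra h
      exact absurd (hN h) (not_le.mpr hm)
    refine (Set.finite_Iic (N + 1)).subset ?_
    intro k hk
    by_contra hlt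
    simp only [Set.mem_Iic, not_le] at hlt
    apply hk
    cases k with
    | zero => omega
    | succ k =>
      simp only [diffExpr]
      rw [hz k (by omega), hz (k + 1) (by omega), hz (k + 2) (by omega)]
      simp
  exact h0.of_exponent_ge (by simp)

/-- The operator given by the matrix on the finitely supported sequences. -/
def minimalOp : EllTwo →ₗ.[ℂ] EllTwo where
  domain := finSeq
  toFun :=
    { toFun := fun f => ⟨A.diffExpr (f : EllTwo), A.diffExpr_memℓp f.2⟩
      map_add' := fun _ _ => Subtype.ext (A.diffExpr_add _ _)
      map_smul' := fun _ _ => Subtype.ext (A.diffExpr_smul _ _) }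

/-- The Jacobi operator `J`: the closure of the operator on the finitely supported sequences. -/
def op : EllTwo →ₗ.[ℂ] EllTwo := A.minimalOp.closure

/-- The values `P₀(ζ), P₁(ζ), …` of the orthogonal polynomials of the first kind. -/
def polyP (ζ : ℂ) : ℕ → ℂ
  | 0 => 1
  | 1 => (ζ - A.q 0) / A.b 0
  | k + 2 => ((ζ - A.q (k + 1)) * polyP ζ (k + 1) - A.b k * polyP ζ k) / A.b (k + 1)

/-- The values `Q₀(ζ), Q₁(ζ), …` of the orthogonal polynomials of the second kind. -/
def polyQ (ζ : ℂ) : ℕ → ℂ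
  | 0 => 0
  | 1 => 1 / A.b 0
  | k + 2 => ((ζ - A.q (k + 1)) * polyQ ζ (k + 1) - A.b k * polyQ ζ k) / A.b (k + 1)

/-- The Wronskian of two sequences. -/
def wronskian (φ ψ : ℕ → ℂ) (k : ℕ) : ℂ :=
  (A.b k : ℂ) * (φ k * ψ (k + 1) - ψ k * φ (k + 1))

/-- The sequence `v(g)`, for `g ∈ ℝ ∪ {+∞}`, that fixes a boundary condition at infinity:
`v(g) = P(0) + g Q(0)` for real `g`, and `v(+∞) = Q(0)`. -/
def boundarySeq : WithTop ℝ → ℕ → ℂ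
  | (g : ℝ) => fun k => A.polyP 0 k + (g : ℂ) * A.polyQ 0 k
  | ⊤ => fun k => A.polyQ 0 k

/-- The set `D(g)` of all `f` in the domain of `J*` whose Wronskian with `v(g)` vanishes
at infinity. -/
def boundaryDomain (g : WithTop ℝ) : Submodule ℂ EllTwo where
  carrier := {f | f ∈ A.op.adjoint.domain ∧
    Tendsto (A.wronskian (A.boundarySeq g) f) atTop (𝓝 0)}
  zero_mem' := by
    refine ⟨Submodule.zero_mem _, ?_⟩
    have h : A.wronskian (A.boundarySeq g) ((0 : EllTwo) : ℕ → ℂ) = fun _ => 0 := by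
      funext k
      simp [wronskian]
    rw [h]
    exact tendsto_const_nhds
  add_mem' := by
    rintro f₁ f₂ ⟨h₁, t₁⟩ ⟨h₂, t₂⟩
    refine ⟨Submodule.add_mem _ h₁ h₂, ?_⟩
    have h : A.wronskian (A.boundarySeq g) ((f₁ + f₂ : EllTwo) : ℕ → ℂ) =
        fun k => A.wronskian (A.boundarySeq g) f₁ k + A.wronskian (A.boundarySeq g) f₂ k := by
      funext k
      simp only [wronskian, lp.coeFn_add, Pi.add_apply]
      ring
    rw [h]
    simpa using t₁.add t₂
  smul_mem' := by
    rintro c f ⟨h₁, t₁⟩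
    refine ⟨Submodule.smul_mem _ c h₁, ?_⟩
    have h : A.wronskian (A.boundarySeq g) ((c • f : EllTwo) : ℕ → ℂ) =
        fun k => c * A.wronskian (A.boundarySeq g) f k := by
      funext k
      simp only [wronskian, lp.coeFn_smul, Pi.smul_apply, smul_eq_mul]
      ring
    rw [h]
    simpa using t₁.const_mul c

open Classical in
/-- The operator `J(g)`: it is `J` if `J` is self-adjoint, and otherwise the restriction of `J*`
to `D(g)`. -/
def opAt (g : WithTop ℝ) : EllTwo →ₗ.[ℂ] EllTwo :=
  if IsSelfAdjoint A.op then A.op else A.op.adjoint.domRestrict (A.boundaryDomain g)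

/-- The rank one perturbation `J_h(g) = J(g) - h ⟨·, e₁⟩ e₁`, on the domain of `J(g)`. -/
def perturbedOp (h : ℝ) (g : WithTop ℝ) : EllTwo →ₗ.[ℂ] EllTwo :=
  (-((h : ℂ) • (InnerProductSpace.rankOne ℂ firstBasisVector firstBasisVector :
    EllTwo →L[ℂ] EllTwo).toLinearMap)) +ᵥ A.opAt g

end JacobiMatrix

/-- The spectrum of an unbounded operator `T`: the complement of the set of all `z` for which
`T - z` has a bounded everywhere defined two-sided inverse `R`. -/
def opSpectrum (T : EllTwo →ₗ.[ℂ] EllTwo) : Set ℂ :=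
  {z | ¬ ∃ R : EllTwo →L[ℂ] EllTwo,
    (∀ y : EllTwo, ∃ hy : R y ∈ T.domain, T ⟨R y, hy⟩ - z • R y = y) ∧
    (∀ x : T.domain, R (T x - z • (x : EllTwo)) = x)}

/-- The eigenspace of an unbounded operator. -/
def opEigenspace (T : EllTwo →ₗ.[ℂ] EllTwo) (z : ℂ) : Submodule ℂ T.domain :=
  LinearMap.ker (T.toFun - z • T.domain.subtype)

/-- The spectrum is discrete: it has no finite accumulation point, and all of its points are
eigenvalues of finite multiplicity. -/
def HasDiscreteSpectrum (T : EllTwo →ₗ.[ℂ] EllTwo) : Prop :=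
  (∀ z : ℂ, ¬ AccPt z (𝓟 (opSpectrum T))) ∧
    ∀ z ∈ opSpectrum T, opEigenspace T z ≠ ⊥ ∧ FiniteDimensional ℂ (opEigenspace T z)

end

noncomputable section

/-! Write T₁, T₂ for two of the operators J_h(g), c for the difference of their parameters, and
mᵢ(z) = ⟨e₁, (Tᵢ - z)⁻¹ e₁⟩ for their Weyl functions. The resolvent identity gives (1 + c m₂)(1 - c
m₁) = 1 (`mul_weylFun_eq_one`). Since e₁ is cyclic, mᵢ has a simple pole at every point of σ(Tᵢ)
(`exists_weylFun_eq`). So 1 + c m₂ has simple poles exactly on σ(T₂) and simple zeros exactly on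
σ(T₁): the two spectra are its divisor (`meromorphicOrderAt_eq`).

The divisor determines the function up to a factor. Off the real line Im m₂ has the sign of Im z, so
1 + c m₂ takes values in the slit plane. The quotient of two such functions with equal divisors is a
zero-free entire function e^G with Im G bounded, and Liouville's theorem makes G constant
(`const_of_mul_eq_slitPlane`). No product formula for the spectra is needed. As z = iy goes to
infinity, m₂ → 0 fixes the factor as 1, and z m₂ → -1 then fixes c; hence m₂ itself is known
(`weylFun_eq_of_opSpectrum_eq`).

The Weyl function determines the matrix of T₂ entry by entry, from the behaviour at infinity of the
diagonal entries of the resolvent (`matrix_eq_of_weylFun_eq`). That matrix is the one of J with q₁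
lowered by the parameter of T₂; if this parameter is given, q₁ is recovered, and c yields the other
parameter. Finally (T₂ - z)⁻¹e₁ is one sequence satisfying the conditions for g and for g'. When J ≠
J*, all solutions are square summable, and a Wronskian identity excludes g ≠ g' (`boundary_unique`).

The spectral theorem is avoided: of the operators only symmetry, cyclicity of e₁ and a spectrum of
isolated real points are used (`IsRealDiscrete`). -/

/-! ### Meromorphic functions determined by their zeros and poles -/

theorem exists_exp_eq_of_differentiable {E : ℂ → ℂ} (hE : Differentiable ℂ E) (h0 : ∀ z, E z ≠ 0) :
    ∃ G : ℂ → ℂ, Differentiable ℂ G ∧ ∀ z, Complex.exp (G z) = E z := by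
  have hL : Differentiable ℂ fun z => deriv E z / E z := fun z =>
    ((hE.analyticAt z).deriv.differentiableAt).div (hE z) (h0 z)
  -- A primitive G of the logarithmic derivative makes e^(-G) E constant; adding a constant to G
  -- turns it into a logarithm of E.
  obtain ⟨G, hG⟩ := hL.isExactOn_univ
  have hG' : ∀ z, HasDerivAt G (deriv E z / E z) z := fun z => hG z trivial
  have hc : ∀ z w, Complex.exp (-G z) * E z = Complex.exp (-G w) * E w := by
    refine is_const_of_deriv_eq_zero (𝕜 := ℂ)
      (f := fun z => Complex.exp (-G z) * E z) ?_ ?_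
    · exact fun z => ((hG' z).differentiableAt.neg.cexp).mul (hE z)
    · intro z
      have := ((hG' z).neg.cexp).mul (hE z).hasDerivAt
      refine (HasDerivAt.deriv this).trans ?_
      field_simp [h0 z]
      ring
  refine ⟨fun z => G z + (Complex.log (E 0) - G 0),
    fun z => (hG' z).differentiableAt.add_const _, fun z => ?_⟩
  have := hc z 0
  rw [Complex.exp_add, Complex.exp_sub, Complex.exp_log (h0 0)]
  rw [Complex.exp_neg, Complex.exp_neg] at this
  have e1 := Complex.exp_ne_zero (G z)
  have e2 := Complex.exp_ne_zero (G 0)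
  field_simp at this ⊢
  linear_combination -this

/-- Two logarithms of the same function differ by a constant on a preconnected open set, so that
the imaginary part of one is bounded if that of the other is. -/
theorem exists_im_bound {U : Set ℂ} (hU : IsOpen U) (hc : IsPreconnected U) {G H : ℂ → ℂ}
    (hG : DifferentiableOn ℂ G U) (hH : DifferentiableOn ℂ H U)
    (h : ∀ z ∈ U, Complex.exp (G z) = Complex.exp (H z)) {C : ℝ}
    (hC : ∀ z ∈ U, |(H z).im| ≤ C) : ∃ C', ∀ z ∈ U, |(G z).im| ≤ C' := by
  rcases U.eq_empty_or_nonempty with rfl | ⟨w, hw⟩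
  · exact ⟨0, by simp⟩
  have hd : U.EqOn (deriv fun z => G z - H z) 0 := by
    intro z hz
    have hGz := (hG.differentiableAt (hU.mem_nhds hz))
    have hHz := (hH.differentiableAt (hU.mem_nhds hz))
    have e : (fun w => Complex.exp (G w)) =ᶠ[𝓝 z] fun w => Complex.exp (H w) :=
      Filter.eventually_of_mem (hU.mem_nhds hz) h
    have e' := e.deriv_eq
    rw [hGz.hasDerivAt.cexp.deriv, hHz.hasDerivAt.cexp.deriv, h z hz] at e'
    have := mul_left_cancel₀ (Complex.exp_ne_zero _) e'
    exact (hGz.hasDerivAt.sub hHz.hasDerivAt).deriv.trans (by simp [this])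
  have key : ∀ z ∈ U, G z - H z = G w - H w := fun z hz =>
    hU.is_const_of_deriv_eq_zero hc (hG.sub hH) hd hz hw
  refine ⟨C + |(G w - H w).im|, fun z hz => ?_⟩
  have : (G z).im = (H z).im + (G w - H w).im := by
    rw [← key z hz]; simp
  rw [this]
  exact (abs_add_le _ _).trans (by gcongr; exact hC z hz)

theorem isPreconnected_im_pos : IsPreconnected {z : ℂ | 0 < z.im} :=
  (convex_halfSpace_im_gt 0).isPreconnected

theorem isPreconnected_im_neg : IsPreconnected {z : ℂ | z.im < 0} :=
  (convex_halfSpace_im_lt 0).isPreconnected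

theorem dense_im_ne_zero : Dense {z : ℂ | z.im ≠ 0} := by
  intro z
  rw [mem_closure_iff_seq_limit]
  by_cases hz : z.im = 0
  · refine ⟨fun n : ℕ => z + (1 / ((n : ℝ) + 1) : ℝ) * Complex.I, fun n => ?_, ?_⟩
    · have : (0 : ℝ) < 1 / ((n : ℝ) + 1) := by positivity
      have e : (z + (1 / ((n : ℝ) + 1) : ℝ) * Complex.I).im = 1 / ((n : ℝ) + 1) := by
        simp only [Complex.add_im, hz, Complex.im_ofReal_mul,
          Complex.I_im, mul_one, zero_add]
      exact e.trans_ne this.ne'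
    · have h1 : Tendsto (fun n : ℕ => ((1 / ((n : ℝ) + 1) : ℝ) : ℂ)) atTop (𝓝 ((0 : ℝ) : ℂ)) :=
        (Complex.continuous_ofReal.tendsto _).comp tendsto_one_div_add_atTop_nhds_zero_nat
      simpa using (h1.mul_const Complex.I).const_add z
  · exact ⟨fun _ => z, fun _ => hz, tendsto_const_nhds⟩

/-- A zero-free entire function that is off the real line a quotient of two holomorphic functions
with values in the slit plane is constant. -/
theorem const_of_mul_eq_slitPlane {E F F' : ℂ → ℂ} (hE : Differentiable ℂ E)
    (h0 : ∀ z, E z ≠ 0) (hF : ∀ z : ℂ, z.im ≠ 0 → DifferentiableAt ℂ F z)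
    (hF' : ∀ z : ℂ, z.im ≠ 0 → DifferentiableAt ℂ F' z)
    (hs : ∀ z : ℂ, z.im ≠ 0 → F z ∈ Complex.slitPlane)
    (hs' : ∀ z : ℂ, z.im ≠ 0 → F' z ∈ Complex.slitPlane)
    (h : ∀ z : ℂ, z.im ≠ 0 → E z * F' z = F z) (z w : ℂ) : E z = E w := by
  obtain ⟨G, hG, hGE⟩ := exists_exp_eq_of_differentiable hE h0
  -- On each half-plane log F - log F' is another logarithm of E, with imaginary part at most 2π in
  -- modulus; G differs from it by a constant, which may depend on the half-plane.
  have hb : ∀ U ⊆ {z : ℂ | z.im ≠ 0}, IsOpen U → IsPreconnected U →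
      ∃ C, ∀ z ∈ U, |(G z).im| ≤ C := by
    intro U hUs hU hUc
    refine exists_im_bound hU hUc (H := fun z => Complex.log (F z) - Complex.log (F' z))
      (C := Real.pi + Real.pi)
      hG.differentiableOn (fun z hz => ?_) (fun z hz => ?_) (fun z hz => ?_)
    · exact (((hF z (hUs hz)).clog (hs z (hUs hz))).sub
        ((hF' z (hUs hz)).clog (hs' z (hUs hz)))).differentiableWithinAt
    · have n1 := Complex.slitPlane_ne_zero (hs z (hUs hz))
      have n2 := Complex.slitPlane_ne_zero (hs' z (hUs hz))
      rw [hGE, Complex.exp_sub, Complex.exp_log n1, Complex.exp_log n2, ← h z (hUs hz)]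
      field_simp
    · rw [Complex.sub_im]
      rw [Complex.log_im, Complex.log_im]
      exact (abs_sub _ _).trans (add_le_add (Complex.abs_arg_le_pi _) (Complex.abs_arg_le_pi _))
  obtain ⟨C₁, h₁⟩ := hb {z | 0 < z.im} (fun z hz => ne_of_gt hz)
    (isOpen_lt continuous_const Complex.continuous_im) isPreconnected_im_pos
  obtain ⟨C₂, h₂⟩ := hb {z | z.im < 0} (fun z hz => ne_of_lt hz)
    (isOpen_lt Complex.continuous_im continuous_const) isPreconnected_im_neg
  have hall : ∀ z, |(G z).im| ≤ max C₁ C₂ := by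
    have hcl : IsClosed {z | |(G z).im| ≤ max C₁ C₂} :=
      isClosed_le (Complex.continuous_im.comp hG.continuous).abs continuous_const
    have : {z : ℂ | z.im ≠ 0} ⊆ {z | |(G z).im| ≤ max C₁ C₂} := by
      intro z hz
      rcases lt_or_gt_of_ne hz with h | h
      · exact (h₂ z h).trans (le_max_right _ _)
      · exact (h₁ z h).trans (le_max_left _ _)
    intro z
    exact hcl.closure_subset_iff.2 this (dense_im_ne_zero z)
  -- |exp(-iG)| = exp(Im G), so the bound on Im G makes this entire function bounded.
  have hd : Differentiable ℂ fun z => Complex.exp (-Complex.I * G z) :=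
    (hG.const_mul _).cexp
  have hconst : ∀ z w, Complex.exp (-Complex.I * G z) = Complex.exp (-Complex.I * G w) := by
    refine hd.apply_eq_apply_of_bounded ?_
    rw [isBounded_iff_forall_norm_le]
    refine ⟨Real.exp (max C₁ C₂), ?_⟩
    rintro _ ⟨z, rfl⟩
    rw [Complex.norm_exp]
    refine Real.exp_le_exp.2 ?_
    simpa using (le_abs_self _).trans (hall z)
  have hG0 : ∀ z, deriv G z = 0 := by
    intro z
    have e : deriv (fun z => Complex.exp (-Complex.I * G z)) z = 0 := by
      rw [show (fun z => Complex.exp (-Complex.I * G z)) =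
        fun _ => Complex.exp (-Complex.I * G 0) from funext fun z => hconst z 0]
      simp
    rw [(((hG z).hasDerivAt.const_mul (-Complex.I)).cexp).deriv] at e
    simpa [Complex.exp_ne_zero] using e
  rw [← hGE, ← hGE, is_const_of_deriv_eq_zero hG hG0 z w]

/-- Meromorphic functions with the same zeros and poles, that are holomorphic off the real line
with values in the slit plane, are proportional off the real line. -/
theorem exists_eq_const_mul_of_meromorphicOrderAt_eq {F F' : ℂ → ℂ}
    (hm : ∀ z, MeromorphicAt F z) (hm' : ∀ z, MeromorphicAt F' z)
    (hord : ∀ z, meromorphicOrderAt F z = meromorphicOrderAt F' z)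
    (hF : ∀ z : ℂ, z.im ≠ 0 → AnalyticAt ℂ F z) (hF' : ∀ z : ℂ, z.im ≠ 0 → AnalyticAt ℂ F' z)
    (hs : ∀ z : ℂ, z.im ≠ 0 → F z ∈ Complex.slitPlane)
    (hs' : ∀ z : ℂ, z.im ≠ 0 → F' z ∈ Complex.slitPlane) :
    ∃ c : ℂ, ∀ z : ℂ, z.im ≠ 0 → F z = c * F' z := by
  have hmE : MeromorphicOn (F / F') Set.univ := fun z _ => (hm z).div (hm' z)
  -- Infinite order means vanishing near the point; by the identity theorem it is enough to exclude
  -- this at `Complex.I`.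
  have hfin : ∀ z, meromorphicOrderAt F' z ≠ ⊤ := by
    have hI : meromorphicOrderAt F' Complex.I ≠ ⊤ := by
      have h1 := hF' Complex.I (by simp)
      have h2 := Complex.slitPlane_ne_zero (hs' Complex.I (by simp))
      rw [h1.meromorphicOrderAt_eq, h1.analyticOrderAt_eq_zero.2 h2]
      simp
    exact fun z => MeromorphicOn.meromorphicOrderAt_ne_top_of_isPreconnected
      (U := Set.univ) (fun z _ => hm' z) isPreconnected_univ trivial trivial hI
  have hzero : ∀ z, meromorphicOrderAt (F / F') z = 0 := by
    intro z
    rw [div_eq_mul_inv, meromorphicOrderAt_mul (hm z) (hm' z).inv, meromorphicOrderAt_inv,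
      hord z]
    lift meromorphicOrderAt F' z to ℤ using hfin z with n
    norm_cast
    simp
  -- The normal form repairs the values of F / F' at the real zeros and poles; order 0 in normal
  -- form means analytic and nonzero.
  set E := toMeromorphicNFOn (F / F') Set.univ with hEdef
  have hNF : ∀ z, MeromorphicNFAt E z := fun z =>
    meromorphicNFOn_toMeromorphicNFOn _ _ (Set.mem_univ z)
  have hEord : ∀ z, meromorphicOrderAt E z = 0 := fun z => by
    rw [hEdef, meromorphicOrderAt_toMeromorphicNFOn hmE trivial, hzero z]
  have hEan : ∀ z, AnalyticAt ℂ E z := fun z =>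
    (hNF z).meromorphicOrderAt_nonneg_iff_analyticAt.1 (hEord z).ge
  have hE0 : ∀ z, E z ≠ 0 := fun z => (hNF z).meromorphicOrderAt_eq_zero_iff.1 (hEord z)
  have hEF : ∀ z : ℂ, z.im ≠ 0 → E z * F' z = F z := by
    intro z hz
    have h2 := Complex.slitPlane_ne_zero (hs' z hz)
    have han : AnalyticAt ℂ (F / F') z := (hF z hz).div (hF' z hz) h2
    have e : E z = (F / F') z := by
      have h1 : E =ᶠ[𝓝[≠] z] F / F' :=
        
        hmE.toMeromorphicNFOn_eq_self_on_nhdsNE (Set.mem_univ z)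
      exact (((hNF z).eventuallyEq_nhdsNE_iff_eventuallyEq_nhds han.meromorphicNFAt).1
        h1).eq_of_nhds
    rw [e, Pi.div_apply]
    field_simp
  have hEd : Differentiable ℂ E := fun z => (hEan z).differentiableAt
  refine ⟨E 0, fun z hz => ?_⟩
  rw [← hEF z hz, const_of_mul_eq_slitPlane hEd hE0 (fun z hz => (hF z hz).differentiableAt)
    (fun z hz => (hF' z hz).differentiableAt) hs hs' hEF z 0]

/-! ### Resolvents and Weyl functions -/

/-- The resolvent `(T - z)⁻¹`, with value `0` on the spectrum. -/
def resolv (T : EllTwo →ₗ.[ℂ] EllTwo) (z : ℂ) : EllTwo →L[ℂ] EllTwo :=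
  open Classical in if h : z ∉ opSpectrum T then (not_not.1 h).choose else 0

/-- The Weyl function `⟨e₁, (T - z)⁻¹ e₁⟩`. -/
def weylFun (T : EllTwo →ₗ.[ℂ] EllTwo) (z : ℂ) : ℂ :=
  inner ℂ firstBasisVector (resolv T z firstBasisVector)

section Resolvent

variable {T : EllTwo →ₗ.[ℂ] EllTwo} {z w : ℂ}

theorem resolv_mem (hz : z ∉ opSpectrum T) (y : EllTwo) : resolv T z y ∈ T.domain := by
  rw [resolv, dif_pos hz]
  exact ((not_not.1 hz).choose_spec.1 y).1

theorem apply_resolv (hz : z ∉ opSpectrum T) (y : EllTwo) :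
    T ⟨resolv T z y, resolv_mem hz y⟩ = y + z • resolv T z y := by
  have h := ((not_not.1 hz).choose_spec.1 y).2
  simp only [resolv, dif_pos hz]
  rw [← sub_eq_iff_eq_add]
  exact h

theorem resolv_apply (hz : z ∉ opSpectrum T) (x : T.domain) :
    resolv T z (T x) = x + z • resolv T z x := by
  have h := (not_not.1 hz).choose_spec.2 x
  simp only [resolv, dif_pos hz]
  rw [map_sub, map_smul, sub_eq_iff_eq_add] at h
  exact h

theorem notMem_opSpectrum {R : EllTwo →L[ℂ] EllTwo} (hR : ∀ y, R y ∈ T.domain)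
    (h₁ : ∀ y, T ⟨R y, hR y⟩ = y + z • R y) (h₂ : ∀ x : T.domain, R (T x) = x + z • R x) :
    z ∉ opSpectrum T :=
  not_not.2 ⟨R, fun y => ⟨hR y, by rw [h₁]; simp⟩, fun x => by rw [map_sub, map_smul, h₂]; simp⟩

theorem resolv_sub_resolv (hz : z ∉ opSpectrum T) (hw : w ∉ opSpectrum T) :
    resolv T z - resolv T w = (z - w) • (resolv T z * resolv T w) := by
  ext1 y
  have h := resolv_apply hz ⟨resolv T w y, resolv_mem hw y⟩
  rw [apply_resolv hw y, map_add, map_smul] at h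
  change resolv T z y - resolv T w y = (z - w) • resolv T z (resolv T w y)
  rw [sub_smul, sub_eq_sub_iff_add_eq_add, h, add_comm]

/-- In ‖R(z)‖ ≤ ‖R(w)‖ + |z - w| ‖R(z)‖ ‖R(w)‖ the last term is absorbed on the left once |z - w|
‖R(w)‖ < 1/2. -/
theorem eventually_norm_resolv_le (hw : w ∉ opSpectrum T)
    (h : ∀ᶠ z in 𝓝 w, z ∉ opSpectrum T) :
    ∀ᶠ z in 𝓝 w, ‖resolv T z‖ ≤ 2 * ‖resolv T w‖ := by
  have h1 : ∀ᶠ z in 𝓝 w, ‖z - w‖ * ‖resolv T w‖ < 1 / 2 := by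
    have : Tendsto (fun z : ℂ => ‖z - w‖ * ‖resolv T w‖) (𝓝 w) (𝓝 (‖w - w‖ * ‖resolv T w‖)) :=
      Continuous.tendsto (by fun_prop) w
    rw [sub_self, norm_zero, zero_mul] at this
    exact this.eventually_lt_const (by norm_num)
  filter_upwards [h, h1] with z hz hz1
  have e := resolv_sub_resolv hz hw
  have : ‖resolv T z‖ ≤ ‖resolv T w‖ + ‖z - w‖ * (‖resolv T z‖ * ‖resolv T w‖) := by
    calc ‖resolv T z‖ = ‖resolv T w + (z - w) • (resolv T z * resolv T w)‖ := by
          rw [← e]; congr 1; abel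
      _ ≤ _ := (norm_add_le _ _).trans (by
          rw [norm_smul]
          gcongr
          exact norm_mul_le _ _)
  nlinarith [norm_nonneg (resolv T z), norm_nonneg (resolv T w), norm_nonneg (z - w)]

theorem hasDerivAt_resolv (h : ∀ᶠ z in 𝓝 w, z ∉ opSpectrum T) :
    HasDerivAt (resolv T) (resolv T w * resolv T w) w := by
  have hw := h.self_of_nhds
  have hcont : Tendsto (resolv T) (𝓝 w) (𝓝 (resolv T w)) := by
    rw [tendsto_iff_norm_sub_tendsto_zero]
    have hb : Tendsto (fun z : ℂ => ‖z - w‖ * (2 * ‖resolv T w‖ * ‖resolv T w‖)) (𝓝 w)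
        (𝓝 (‖w - w‖ * (2 * ‖resolv T w‖ * ‖resolv T w‖))) :=
      Continuous.tendsto (by fun_prop) w
    rw [sub_self, norm_zero, zero_mul] at hb
    refine squeeze_zero' (Eventually.of_forall fun _ => norm_nonneg _) ?_ hb
    filter_upwards [h, eventually_norm_resolv_le hw h] with z hz hz'
    rw [resolv_sub_resolv hz hw, norm_smul]
    gcongr
    exact (norm_mul_le _ _).trans (by gcongr)
  rw [hasDerivAt_iff_tendsto_slope]
  have hc : Tendsto (fun z => resolv T z * resolv T w) (𝓝[≠] w)
      (𝓝 (resolv T w * resolv T w)) :=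
    (hcont.mono_left nhdsWithin_le_nhds).mul_const _
  refine hc.congr' ?_
  filter_upwards [h.filter_mono nhdsWithin_le_nhds, self_mem_nhdsWithin] with z hz hne
  rw [slope_def_module, resolv_sub_resolv hz hw, smul_smul, inv_mul_cancel₀ (sub_ne_zero.2 hne),
    one_smul]

theorem analyticAt_resolv (h : ∀ᶠ z in 𝓝 w, z ∉ opSpectrum T) :
    AnalyticAt ℂ (resolv T) w := by
  rw [Complex.analyticAt_iff_eventually_differentiableAt]
  filter_upwards [h.eventually_nhds] with z hz
  exact (hasDerivAt_resolv hz).differentiableAt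

theorem AnalyticAt.inner_apply {S : ℂ → EllTwo →L[ℂ] EllTwo} (hS : AnalyticAt ℂ S w)
    (x y : EllTwo) : AnalyticAt ℂ (fun z => inner ℂ x (S z y)) w :=
  (((innerSL ℂ x).comp (ContinuousLinearMap.apply ℂ EllTwo y)).analyticAt _).comp hS

theorem analyticAt_weylFun (h : ∀ᶠ z in 𝓝 w, z ∉ opSpectrum T) : AnalyticAt ℂ (weylFun T) w :=
  (analyticAt_resolv h).inner_apply _ _

end Resolvent

/-! ### Resolvent bounds for symmetric operators -/

section Symmetric

variable {T : EllTwo →ₗ.[ℂ] EllTwo} {z : ℂ}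

theorem LinearPMap.IsFormalAdjoint.im_inner (hT : T.IsFormalAdjoint T) (x : T.domain) :
    (inner ℂ (x : EllTwo) (T x)).im = 0 := by
  have h := hT x x
  rw [← inner_conj_symm] at h
  exact Complex.conj_eq_iff_im.1 h

/-- The number ⟨Ry, TRy⟩ is real, and TRy = y + zRy. -/
theorem im_inner_resolv (hT : T.IsFormalAdjoint T) (hz : z ∉ opSpectrum T) (y : EllTwo) :
    (inner ℂ y (resolv T z y)).im = z.im * ‖resolv T z y‖ ^ 2 := by
  have h := hT.im_inner ⟨resolv T z y, resolv_mem hz y⟩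
  rw [apply_resolv hz] at h
  simp only [inner_add_right, inner_smul_right, inner_self_eq_norm_sq_to_K] at h
  rw [← inner_conj_symm, Complex.conj_im]
  have e : (z * ((‖resolv T z y‖ : ℝ) : ℂ) ^ 2).im = z.im * ‖resolv T z y‖ ^ 2 := by
    rw [← Complex.ofReal_pow, Complex.im_mul_ofReal]
  rw [Complex.add_im] at h
  linarith [e, h.symm.trans (congrArg _ e)]

theorem im_weylFun (hT : T.IsFormalAdjoint T) (hz : z ∉ opSpectrum T) :
    (weylFun T z).im = z.im * ‖resolv T z firstBasisVector‖ ^ 2 :=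
  im_inner_resolv hT hz _

theorem norm_resolv_apply_le (hT : T.IsFormalAdjoint T) (hz : z ∉ opSpectrum T) (y : EllTwo) :
    |z.im| * ‖resolv T z y‖ ≤ ‖y‖ := by
  have h := im_inner_resolv hT hz y
  have h2 : |z.im * ‖resolv T z y‖ ^ 2| ≤ ‖y‖ * ‖resolv T z y‖ := by
    rw [← h]
    exact (Complex.abs_im_le_norm _).trans (norm_inner_le_norm _ _)
  rw [abs_mul, abs_of_nonneg (sq_nonneg ‖resolv T z y‖)] at h2
  rcases (norm_nonneg (resolv T z y)).eq_or_lt with h0 | h0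
  · rw [← h0, mul_zero]
    exact norm_nonneg _
  · refine le_of_mul_le_mul_right ?_ h0
    linarith

theorem norm_resolv_le (hT : T.IsFormalAdjoint T) (hz : z ∉ opSpectrum T) :
    |z.im| * ‖resolv T z‖ ≤ 1 := by
  rcases (abs_nonneg z.im).eq_or_lt with h0 | h0
  · rw [← h0]; simp
  · rw [mul_comm, ← le_div_iff₀ h0]
    refine ContinuousLinearMap.opNorm_le_bound _ (by positivity) fun y => ?_
    rw [div_mul_eq_mul_div, one_mul, le_div_iff₀ h0, mul_comm]
    exact norm_resolv_apply_le hT hz y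

end Symmetric


/-! ### Isolated points of the spectrum are simple poles -/

section IsolatedPoint

variable {T : EllTwo →ₗ.[ℂ] EllTwo} {x₀ : ℝ}

/-- Near an isolated real point of the spectrum of a symmetric operator the resolvent grows at most
like the inverse square of the distance. -/
theorem exists_norm_sq_smul_resolv_le (hT : T.IsFormalAdjoint T)
    (h : ∀ᶠ z : ℂ in 𝓝[≠] (x₀ : ℂ), z ∉ opSpectrum T) :
    ∃ C, ∀ᶠ z : ℂ in 𝓝[≠] (x₀ : ℂ), ‖(z - x₀) ^ 2 • resolv T z‖ ≤ C := by
  obtain ⟨r₁, hr₁, hsub⟩ := Metric.mem_nhdsWithin_iff.1 h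
  obtain ⟨r, hr, hrr⟩ := exists_between hr₁
  have hρ : ∀ z : ℂ, z ≠ x₀ → ‖z - x₀‖ ≤ r → ∀ᶠ w in 𝓝 z, w ∉ opSpectrum T := by
    intro z hz hzr
    have : Metric.ball (x₀ : ℂ) r₁ ∩ {(x₀ : ℂ)}ᶜ ∈ 𝓝 z :=
      (Metric.isOpen_ball.inter isOpen_compl_singleton).mem_nhds
        ⟨by rw [mem_ball_iff_norm]; linarith, hz⟩
    exact Filter.mem_of_superset this hsub
  -- Maximum principle on the annulus ρ < |d| < r, where d = z - x₀. On |d| = t one has t² = d·conj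
  -- d, so |d² - t²| = 2t|Im d|, which cancels the bound 1/|Im d| for the resolvent. There is one
  -- such factor for each boundary circle, and the other factor is at most 2r².
  have key : ∀ z : ℂ, ∀ ρ : ℝ, 0 < ρ → ρ < ‖z - x₀‖ → ‖z - x₀‖ < r →
      ‖(((z - x₀) ^ 2 - (ρ : ℂ) ^ 2) * ((z - x₀) ^ 2 - (r : ℂ) ^ 2)) • resolv T z‖
        ≤ 4 * r ^ 3 := by
    intro z ρ hρ0 hρz hzr
    have hcn : Continuous fun w : ℂ => ‖w - x₀‖ := by fun_prop
    set U : Set ℂ := {w | ρ < ‖w - x₀‖ ∧ ‖w - x₀‖ < r} with hU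
    have hcl : closure U ⊆ {w | ρ ≤ ‖w - x₀‖ ∧ ‖w - x₀‖ ≤ r} := by
      refine closure_minimal (fun w hw => ⟨hw.1.le, hw.2.le⟩) ?_
      exact (isClosed_le continuous_const hcn).inter (isClosed_le hcn continuous_const)
    have hUo : IsOpen U := (isOpen_lt continuous_const hcn).inter (isOpen_lt hcn continuous_const)
    refine Complex.norm_le_of_forall_mem_frontier_norm_le (U := U) (f := fun z =>
      (((z - x₀) ^ 2 - (ρ : ℂ) ^ 2) * ((z - x₀) ^ 2 - (r : ℂ) ^ 2)) • resolv T z)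
      ?_ ?_ ?_ (subset_closure ⟨hρz, hzr⟩)
    · refine (Metric.isBounded_ball (x := (x₀ : ℂ)) (r := r)).subset fun w hw => ?_
      rw [mem_ball_iff_norm]
      exact hw.2
    · refine DifferentiableOn.diffContOnCl fun w hw => ?_
      obtain ⟨h1, h2⟩ := hcl hw
      refine DifferentiableAt.differentiableWithinAt ?_
      refine DifferentiableAt.smul (c := fun z : ℂ => ((z - x₀) ^ 2 - (ρ : ℂ) ^ 2) *
        ((z - x₀) ^ 2 - (r : ℂ) ^ 2)) (by fun_prop)
        (hasDerivAt_resolv (hρ w ?_ h2)).differentiableAt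
      rintro rfl
      simp at h1
      linarith
    · intro w hw
      have hwc := hcl hw.1
      have hwU : w ∉ U := by rw [← hUo.interior_eq]; exact hw.2
      have hne : w ≠ x₀ := by
        rintro rfl
        have := hwc.1
        simp at this
        linarith
      have hR := norm_resolv_le hT (hρ w hne hwc.2).self_of_nhds
      set d := w - x₀ with hd
      have him : w.im = d.im := by simp [hd]
      have hsq : ∀ t : ℝ, ‖d‖ = t → ‖d ^ 2 - (t : ℂ) ^ 2‖ = 2 * t * |d.im| := by
        intro t ht
        have : (t : ℂ) ^ 2 = d * (starRingEnd ℂ) d := by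
          rw [Complex.mul_conj, Complex.normSq_eq_norm_sq, ht]; push_cast; ring
        rw [this, sq, ← mul_sub, norm_mul, Complex.sub_conj, norm_mul, Complex.norm_I, ht,
          Complex.norm_real, Real.norm_eq_abs, abs_mul, abs_two]
        ring
      have hle : ∀ t : ℝ, 0 < t → t ≤ r → ‖d ^ 2 - (t : ℂ) ^ 2‖ ≤ 2 * r ^ 2 := by
        intro t ht htr
        refine (norm_sub_le _ _).trans ?_
        rw [norm_pow, norm_pow, Complex.norm_real, Real.norm_eq_abs, abs_of_pos ht]
        have := hwc.2
        nlinarith [norm_nonneg d]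
      rw [norm_smul, norm_mul]
      rw [him] at hR
      have hρr : ρ < r := hρz.trans hzr
      by_cases hc : ‖d‖ = ρ
      · rw [hsq ρ hc]
        calc 2 * ρ * |d.im| * ‖d ^ 2 - (r : ℂ) ^ 2‖ * ‖resolv T w‖
            = 2 * ρ * ‖d ^ 2 - (r : ℂ) ^ 2‖ * (|d.im| * ‖resolv T w‖) := by ring
          _ ≤ 2 * r * (2 * r ^ 2) * 1 := by
              gcongr
              exact hle r hr le_rfl
          _ = _ := by ring
      · have hc' : ‖d‖ = r := by
          by_contra hcr
          exact hwU ⟨lt_of_le_of_ne hwc.1 (Ne.symm hc), lt_of_le_of_ne hwc.2 hcr⟩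
        rw [hsq r hc']
        calc ‖d ^ 2 - (ρ : ℂ) ^ 2‖ * (2 * r * |d.im|) * ‖resolv T w‖
            = 2 * r * ‖d ^ 2 - (ρ : ℂ) ^ 2‖ * (|d.im| * ‖resolv T w‖) := by ring
          _ ≤ 2 * r * (2 * r ^ 2) * 1 := by
              gcongr
              exact hle ρ hρ0 hρr.le
          _ = _ := by ring
  -- Let ρ tend to 0 in `key`; for |d| < r/2 the remaining factor satisfies |d² - r²| ≥ r²/2.
  refine ⟨4 * r ^ 3 / (r ^ 2 / 2), ?_⟩
  have hball : Metric.ball (x₀ : ℂ) (r / 2) ∩ {(x₀ : ℂ)}ᶜ ∈ 𝓝[≠] (x₀ : ℂ) :=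
    inter_mem (mem_nhdsWithin_of_mem_nhds (Metric.ball_mem_nhds _ (by positivity)))
      self_mem_nhdsWithin
  filter_upwards [hball] with z hz
  have hz1 : ‖z - x₀‖ < r / 2 := mem_ball_iff_norm.1 hz.1
  have hz0 : 0 < ‖z - x₀‖ := norm_pos_iff.2 (sub_ne_zero.2 hz.2)
  have hlim : ‖(((z - x₀) ^ 2) * ((z - x₀) ^ 2 - (r : ℂ) ^ 2)) • resolv T z‖ ≤ 4 * r ^ 3 := by
    have ht : Tendsto (fun ρ : ℝ => ‖(((z - x₀) ^ 2 - (ρ : ℂ) ^ 2) *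
        ((z - x₀) ^ 2 - (r : ℂ) ^ 2)) • resolv T z‖) (𝓝[>] 0)
        (𝓝 ‖(((z - x₀) ^ 2 - ((0 : ℝ) : ℂ) ^ 2) *
        ((z - x₀) ^ 2 - (r : ℂ) ^ 2)) • resolv T z‖) :=
      (Continuous.tendsto (by fun_prop) 0).mono_left nhdsWithin_le_nhds
    rw [Complex.ofReal_zero, zero_pow two_ne_zero, sub_zero] at ht
    refine le_of_tendsto ht ?_
    filter_upwards [Ioo_mem_nhdsGT hz0] with ρ hρ
    exact key z ρ hρ.1 hρ.2 (by linarith)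
  rw [mul_comm, mul_smul, norm_smul] at hlim
  rw [le_div_iff₀ (by positivity), mul_comm]
  refine le_trans ?_ hlim
  gcongr
  have h1 := norm_sub_norm_le ((r : ℂ) ^ 2) ((z - x₀) ^ 2)
  rw [norm_sub_rev, norm_pow, norm_pow, Complex.norm_real, Real.norm_eq_abs, abs_of_pos hr] at h1
  nlinarith

theorem exists_analyticAt_eq_of_bounded {F : Type*} [NormedAddCommGroup F] [NormedSpace ℂ F]
    [CompleteSpace F] {f : ℂ → F} {c : ℂ} (hf : ∀ᶠ z in 𝓝[≠] c, DifferentiableAt ℂ f z) {C : ℝ}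
    (hC : ∀ᶠ z in 𝓝[≠] c, ‖f z‖ ≤ C) : ∃ g : ℂ → F, AnalyticAt ℂ g c ∧ f =ᶠ[𝓝[≠] c] g := by
  have hl := Complex.tendsto_limUnder_of_differentiable_on_punctured_nhds_of_bounded_under hf
    ⟨C + ‖f c‖, eventually_map.2 (hC.mono fun z hz => (norm_sub_le _ _).trans (by gcongr))⟩
  have he : f =ᶠ[𝓝[≠] c] Function.update f c (limUnder (𝓝[≠] c) f) := by
    filter_upwards [self_mem_nhdsWithin] with z hz
    exact (Function.update_of_ne hz _ _).symm
  refine ⟨_, Complex.analyticAt_of_differentiable_on_punctured_nhds_of_continuousAt ?_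
    (continuousAt_update_same.2 hl), he⟩
  filter_upwards [hf, self_mem_nhdsWithin] with z hz hzc
  refine hz.congr_of_eventuallyEq ?_
  filter_upwards [isOpen_compl_singleton.mem_nhds hzc] with w hw
  exact Function.update_of_ne hw _ _

theorem AnalyticAt.exists_eq_smul_of_eq_zero {F : Type*} [NormedAddCommGroup F] [NormedSpace ℂ F]
    {f : ℂ → F} {c : ℂ} (hf : AnalyticAt ℂ f c) (h0 : f c = 0) :
    ∃ g : ℂ → F, AnalyticAt ℂ g c ∧ ∀ z, f z = (z - c) • g z := by
  obtain ⟨p, hp⟩ := hf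
  exact ⟨dslope f c, ⟨_, hp.has_fpower_series_dslope_fslope⟩,
    fun z => by rw [sub_smul_dslope, h0, sub_zero]⟩

theorem tendsto_add_mul_I (x₀ : ℝ) :
    Tendsto (fun y : ℝ => (x₀ : ℂ) + y * Complex.I) (𝓝[>] 0) (𝓝[≠] (x₀ : ℂ)) := by
  refine tendsto_nhdsWithin_iff.2 ⟨?_, ?_⟩
  · have : Tendsto (fun y : ℝ => (x₀ : ℂ) + y * Complex.I) (𝓝 0)
        (𝓝 ((x₀ : ℂ) + (0 : ℝ) * Complex.I)) := Continuous.tendsto (by fun_prop) 0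
    simpa using this.mono_left nhdsWithin_le_nhds
  · filter_upwards [self_mem_nhdsWithin] with y hy
    simpa using (ne_of_gt hy)

/-- At an isolated real point of the spectrum of a symmetric operator the resolvent has at most a
simple pole. -/
theorem exists_sub_smul_resolv_eq (hT : T.IsFormalAdjoint T)
    (h : ∀ᶠ z : ℂ in 𝓝[≠] (x₀ : ℂ), z ∉ opSpectrum T) :
    ∃ S : ℂ → EllTwo →L[ℂ] EllTwo, AnalyticAt ℂ S x₀ ∧
      ∀ᶠ z : ℂ in 𝓝[≠] (x₀ : ℂ), (z - x₀) • resolv T z = S z := by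
  obtain ⟨C, hC⟩ := exists_norm_sq_smul_resolv_le hT h
  have hd : ∀ᶠ z : ℂ in 𝓝[≠] (x₀ : ℂ), 
      DifferentiableAt ℂ (fun z : ℂ => (z - x₀) ^ 2 • resolv T z) z := by
    filter_upwards [eventually_eventually_nhdsWithin.2 h, self_mem_nhdsWithin] with z hz hne
    rw [isOpen_compl_singleton.nhdsWithin_eq hne] at hz
    exact DifferentiableAt.smul (c := fun z : ℂ => (z - x₀) ^ 2) (by fun_prop)
      (hasDerivAt_resolv hz).differentiableAt
  obtain ⟨S, hS, hSe⟩ := exists_analyticAt_eq_of_bounded hd hC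
  -- At z = x₀ + iy the norm is y²‖R(z)‖ ≤ y, so the double pole is absent.
  have h0 : S x₀ = 0 := by
    have h1 : Tendsto (fun y : ℝ => S ((x₀ : ℂ) + y * Complex.I)) (𝓝[>] 0) (𝓝 (S x₀)) :=
      (hS.continuousAt.tendsto.mono_left nhdsWithin_le_nhds).comp (tendsto_add_mul_I x₀)
    refine tendsto_nhds_unique h1 ?_
    have h2 := (tendsto_add_mul_I x₀).eventually (hSe.and h)
    refine squeeze_zero_norm' (a := fun y : ℝ => y) ?_ (tendsto_id.mono_left nhdsWithin_le_nhds)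
    filter_upwards [h2, self_mem_nhdsWithin] with y hy hy0
    have hy0 : 0 < y := hy0
    have hR := norm_resolv_le hT hy.2
    rw [← hy.1, norm_smul]
    simp [abs_of_pos hy0] at hR ⊢
    nlinarith
  obtain ⟨S₁, hS₁, hSS⟩ := hS.exists_eq_smul_of_eq_zero h0
  refine ⟨S₁, hS₁, ?_⟩
  filter_upwards [hSe, self_mem_nhdsWithin] with z hz hne
  have hne : z - x₀ ≠ 0 := sub_ne_zero.2 hne
  have := hz.trans (hSS z)
  rw [sq, mul_smul] at this
  exact smul_right_injective _ hne this

/-- No nonzero bounded operator vanishes on the first basis vector while its kernel is invariant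
under `T`. -/
def FirstVectorCyclic (T : EllTwo →ₗ.[ℂ] EllTwo) : Prop :=
  ∀ S : EllTwo →L[ℂ] EllTwo, S firstBasisVector = 0 →
    (∀ x : T.domain, S x = 0 → S (T x) = 0) → S = 0

/-- At an isolated real point of the spectrum the Weyl function has a simple pole. -/
theorem exists_weylFun_eq (hT : T.IsFormalAdjoint T) (hcyc : FirstVectorCyclic T)
    (h : ∀ᶠ z : ℂ in 𝓝[≠] (x₀ : ℂ), z ∉ opSpectrum T) :
    ∃ s : ℂ → ℂ, AnalyticAt ℂ s x₀ ∧
      (∀ᶠ z : ℂ in 𝓝[≠] (x₀ : ℂ), weylFun T z = (z - x₀)⁻¹ * s z) ∧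
      ((x₀ : ℂ) ∈ opSpectrum T → s x₀ ≠ 0) := by
  obtain ⟨S, hS, hSe⟩ := exists_sub_smul_resolv_eq hT h
  refine ⟨fun z => inner ℂ firstBasisVector (S z firstBasisVector), hS.inner_apply _ _, ?_, ?_⟩
  · filter_upwards [hSe, self_mem_nhdsWithin] with z hz hne
    have hne : z - x₀ ≠ 0 := sub_ne_zero.2 hne
    rw [← hz, weylFun, smul_apply, inner_smul_right]
    field_simp
  · intro hmem hs
    refine absurd hmem ?_
    have hSy : ∀ y, Tendsto (fun z => S z y) (𝓝[≠] (x₀ : ℂ)) (𝓝 (S x₀ y)) := fun y =>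
      (((ContinuousLinearMap.apply ℂ EllTwo y).continuous.tendsto _).comp
        hS.continuousAt.tendsto).mono_left nhdsWithin_le_nhds
    -- At z = x₀ + iy, ‖S(z)e₁‖² = y²‖R(z)e₁‖² = y Im m(z) ≤ |⟨e₁, S(z)e₁⟩|, which tends to 0 by
    -- assumption.
    have hSe0 : S x₀ firstBasisVector = 0 := by
      have h1 := (hSy firstBasisVector).comp (tendsto_add_mul_I x₀)
      have h2 : Tendsto (fun y : ℝ => (inner ℂ firstBasisVector
          (S ((x₀ : ℂ) + y * Complex.I) firstBasisVector) : ℂ)) (𝓝[>] 0) (𝓝 0) := by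
        have := ((innerSL ℂ firstBasisVector).continuous.tendsto _).comp h1
        rw [innerSL_apply_apply, show (inner ℂ firstBasisVector (S x₀ firstBasisVector) : ℂ) = 0
          from hs] at this
        exact this
      have h3 : Tendsto (fun y : ℝ => ‖S ((x₀ : ℂ) + y * Complex.I) firstBasisVector‖ ^ 2)
          (𝓝[>] 0) (𝓝 0) := by
        have h2' := h2.norm
        rw [norm_zero] at h2'
        refine squeeze_zero' (Eventually.of_forall fun _ => sq_nonneg _) ?_ h2'
        filter_upwards [(tendsto_add_mul_I x₀).eventually (hSe.and h), self_mem_nhdsWithin]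
          with y hy hy0
        have hy0 : 0 < y := hy0
        have him := im_weylFun hT hy.2
        have hle := Complex.abs_im_le_norm (weylFun T ((x₀ : ℂ) + y * Complex.I))
        rw [weylFun] at him hle
        rw [← hy.1, smul_apply, inner_smul_right, norm_smul, norm_mul]
        simp only [Complex.add_im, Complex.ofReal_im, Complex.im_ofReal_mul, Complex.I_im,
          mul_one, zero_add, add_sub_cancel_left, norm_mul, Complex.norm_real, Complex.norm_I,
          Real.norm_eq_abs, abs_of_pos hy0] at him ⊢
        rw [him, abs_of_nonneg (by positivity)] at hle
        rw [mul_pow]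
        nlinarith
      have h4 := (h1.norm.pow 2)
      have h5 := tendsto_nhds_unique h4 h3
      simpa using h5
    -- Multiplying R(z)Tx = x + zR(z)x by z - x₀ and passing to the limit gives S(x₀)Tx = x₀S(x₀)x,
    -- so the kernel of S(x₀) is invariant and cyclicity applies.
    have hS0 : S x₀ = 0 := by
      refine hcyc _ hSe0 fun x hx => ?_
      have h1 := hSy (T x)
      have h2 : Tendsto (fun z : ℂ => (z - x₀) • (x : EllTwo) + z • S z x) (𝓝[≠] (x₀ : ℂ))
          (𝓝 (((x₀ : ℂ) - x₀) • (x : EllTwo) + (x₀ : ℂ) • S x₀ x)) := by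
        refine Tendsto.add ?_ (Tendsto.smul (tendsto_id.mono_left nhdsWithin_le_nhds) (hSy x))
        exact (Continuous.tendsto (by fun_prop) _).mono_left nhdsWithin_le_nhds
      rw [hx, sub_self, zero_smul, smul_zero, add_zero] at h2
      refine tendsto_nhds_unique (h1.congr' ?_) h2
      filter_upwards [h, hSe] with z hz hz'
      rw [← hz', smul_apply, smul_apply, resolv_apply hz,
        smul_add, smul_comm]
    obtain ⟨R, hR, hRS⟩ := hS.exists_eq_smul_of_eq_zero hS0
    have hRe : ∀ᶠ z : ℂ in 𝓝[≠] (x₀ : ℂ), resolv T z = R z := by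
      filter_upwards [hSe, self_mem_nhdsWithin] with z hz hne
      exact smul_right_injective _ (sub_ne_zero.2 hne) (hz.trans (hRS z))
    have hRlim : Tendsto (resolv T) (𝓝[≠] (x₀ : ℂ)) (𝓝 (R x₀)) :=
      (hR.continuousAt.tendsto.mono_left nhdsWithin_le_nhds).congr' (hRe.mono fun _ h => h.symm)
    obtain ⟨w, hw⟩ := h.exists
    -- With residue 0 the resolvent has a limit R(x₀), which should invert T - x₀. The limit of the
    -- resolvent identity expresses R(x₀) through the resolvent at w, so its range lies in the
    -- domain.
    have hid : R x₀ = resolv T w + ((x₀ : ℂ) - w) • (resolv T w * R x₀) := by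
      have h1 : Tendsto (fun z => resolv T w + (z - w) • (resolv T w * resolv T z))
          (𝓝[≠] (x₀ : ℂ)) (𝓝 (resolv T w + ((x₀ : ℂ) - w) • (resolv T w * R x₀))) := by
        refine Tendsto.add tendsto_const_nhds (Tendsto.smul ?_ (hRlim.const_mul _))
        exact (Continuous.tendsto (by fun_prop) _).mono_left nhdsWithin_le_nhds
      refine tendsto_nhds_unique hRlim (h1.congr' ?_)
      filter_upwards [h] with z hz
      have := resolv_sub_resolv hw hz
      rw [← neg_sub w z, neg_smul, ← this]
      abel
    have hy : ∀ y, R x₀ y = resolv T w (y + ((x₀ : ℂ) - w) • R x₀ y) := fun y => by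
      conv_lhs => rw [hid]
      rw [map_add, map_smul]
      rfl
    refine notMem_opSpectrum (R := R x₀) (fun y => ?_) (fun y => ?_) (fun x => ?_)
    · rw [hy]; exact resolv_mem hw _
    · have e : (⟨R x₀ y, by rw [hy]; exact resolv_mem hw _⟩ : T.domain) =
          ⟨resolv T w (y + ((x₀ : ℂ) - w) • R x₀ y), resolv_mem hw _⟩ := Subtype.ext (hy y)
      rw [e, apply_resolv hw, ← hy, sub_smul]
      abel
    · have h1 : Tendsto (fun z => resolv T z (T x)) (𝓝[≠] (x₀ : ℂ)) (𝓝 (R x₀ (T x))) :=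
        ((ContinuousLinearMap.apply ℂ EllTwo (T x)).continuous.tendsto _).comp hRlim
      have h2 : Tendsto (fun z => (x : EllTwo) + z • resolv T z x) (𝓝[≠] (x₀ : ℂ))
          (𝓝 ((x : EllTwo) + (x₀ : ℂ) • R x₀ x)) :=
        tendsto_const_nhds.add (Tendsto.smul (tendsto_id.mono_left nhdsWithin_le_nhds)
          (((ContinuousLinearMap.apply ℂ EllTwo (x : EllTwo)).continuous.tendsto _).comp hRlim))
      refine tendsto_nhds_unique (h1.congr' ?_) h2
      filter_upwards [h] with z hz
      exact resolv_apply hz x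

end IsolatedPoint

/-! ### Rank one perturbations -/

theorem firstBasisVector_ne_zero : firstBasisVector ≠ 0 := by
  intro h
  have := congrArg (fun f : EllTwo => (f : ℕ → ℂ) 0) h
  simp [firstBasisVector] at this

theorem inner_firstBasisVector_self : inner ℂ firstBasisVector firstBasisVector = (1 : ℂ) := by
  rw [firstBasisVector, lp.inner_single_left]
  simp

/-- `T₂ = T₁ - c ⟨e₁, ·⟩ e₁`. -/
structure IsRankOnePerturbation (c : ℝ) (T₁ T₂ : EllTwo →ₗ.[ℂ] EllTwo) : Prop where
  domain_eq : T₁.domain = T₂.domain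
  apply_eq : ∀ (x : EllTwo) (h₁ : x ∈ T₁.domain) (h₂ : x ∈ T₂.domain),
    T₂ ⟨x, h₂⟩ = T₁ ⟨x, h₁⟩ - (c * inner ℂ firstBasisVector x) • firstBasisVector

namespace IsRankOnePerturbation

variable {c : ℝ} {T₁ T₂ : EllTwo →ₗ.[ℂ] EllTwo} {z : ℂ}

theorem symm (h : IsRankOnePerturbation c T₁ T₂) : IsRankOnePerturbation (-c) T₂ T₁ where
  domain_eq := h.domain_eq.symm
  apply_eq x h₁ h₂ := by
    rw [h.apply_eq x h₂ h₁, Complex.ofReal_neg, neg_mul, neg_smul]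
    abel

/-- For x = R₁e₁ one has (T₂ - z)x = (1 - c m₁)e₁; applying R₂ and pairing with e₁ gives m₁ = (1 - c
m₁)m₂. -/
theorem mul_weylFun_eq_one (h : IsRankOnePerturbation c T₁ T₂) (h₁ : z ∉ opSpectrum T₁)
    (h₂ : z ∉ opSpectrum T₂) : (1 + c * weylFun T₂ z) * (1 - c * weylFun T₁ z) = 1 := by
  set x := resolv T₁ z firstBasisVector with hx
  have hx₁ : x ∈ T₁.domain := resolv_mem h₁ _
  have hx₂ : x ∈ T₂.domain := h.domain_eq ▸ hx₁
  have e₁ : T₁ ⟨x, hx₁⟩ = firstBasisVector + z • x := apply_resolv h₁ _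
  have e₂ := resolv_apply h₂ ⟨x, hx₂⟩
  rw [h.apply_eq x hx₁ hx₂, e₁] at e₂
  have e₃ := congrArg (fun y : EllTwo => (inner ℂ firstBasisVector y : ℂ)) e₂
  simp only [map_sub, map_add, map_smul, inner_sub_right, inner_add_right, inner_smul_right] at e₃
  have m₁ : weylFun T₁ z = inner ℂ firstBasisVector x := rfl
  have m₂ : weylFun T₂ z = inner ℂ firstBasisVector (resolv T₂ z firstBasisVector) := rfl
  rw [← m₁, ← m₂] at e₃
  linear_combination (c : ℂ) * e₃

/-- Krein's formula: R₂y = Ry + κ⟨e₁, Ry⟩Re₁ with κ = c/(1 - c m₁). Writing this as R applied to a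
corrected vector makes membership in the domain immediate. -/
theorem notMem_opSpectrum (h : IsRankOnePerturbation c T₁ T₂) (h₁ : z ∉ opSpectrum T₁)
    (hne : 1 - c * weylFun T₁ z ≠ 0) : z ∉ opSpectrum T₂ := by
  set R := resolv T₁ z with hR
  set x := R firstBasisVector with hx
  set κ : ℂ := c / (1 - c * weylFun T₁ z) with hκ
  have hκ' : κ * (1 - c * weylFun T₁ z) = c := div_mul_cancel₀ _ hne
  have hm : weylFun T₁ z = inner ℂ firstBasisVector x := rfl
  let R₂ : EllTwo →L[ℂ] EllTwo :=
    R + ((innerSL ℂ firstBasisVector).comp R).smulRight (κ • x)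
  have hR₂ : ∀ y, R₂ y = R (y + (κ * inner ℂ firstBasisVector (R y)) • firstBasisVector) := by
    intro y
    simp only [R₂, map_add, map_smul]
    change R y + (inner ℂ firstBasisVector (R y) : ℂ) • κ • x = _
    rw [smul_smul, mul_comm]
  have hmem₁ : ∀ y, R₂ y ∈ T₁.domain := fun y => by rw [hR₂]; exact resolv_mem h₁ _
  have hmem : ∀ y, R₂ y ∈ T₂.domain := fun y => h.domain_eq ▸ hmem₁ y
  refine _root_.notMem_opSpectrum (R := R₂) hmem (fun y => ?_) (fun u => ?_)
  · rw [h.apply_eq _ (hmem₁ y) (hmem y)]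
    have e : (⟨R₂ y, hmem₁ y⟩ : T₁.domain) = ⟨R _, resolv_mem h₁
      (y + (κ * inner ℂ firstBasisVector (R y)) • firstBasisVector)⟩ := Subtype.ext (hR₂ y)
    rw [e, apply_resolv h₁, ← hR, ← hR₂]
    have e₂ : (inner ℂ firstBasisVector (R₂ y) : ℂ) = inner ℂ firstBasisVector (R y) +
        κ * inner ℂ firstBasisVector (R y) * weylFun T₁ z := by
      rw [hR₂, map_add, map_smul, inner_add_right, inner_smul_right, hm]
    have e₃ : (c : ℂ) * inner ℂ firstBasisVector (R₂ y) =
        κ * inner ℂ firstBasisVector (R y) := by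
      rw [e₂]
      linear_combination (-inner ℂ firstBasisVector (R y) : ℂ) * hκ'
    rw [e₃]
    abel
  · obtain ⟨u, hu₂⟩ := u
    have hu₁ : u ∈ T₁.domain := h.domain_eq ▸ hu₂
    have e₁ := resolv_apply h₁ ⟨u, hu₁⟩
    simp only at e₁ ⊢
    rw [h.apply_eq u hu₁ hu₂]
    have hs : ∀ y, R₂ y = R y + (κ * inner ℂ firstBasisVector (R y)) • x := by
      intro y
      rw [hR₂, map_add, map_smul]
    rw [hs, hs, map_sub, map_smul]
    rw [e₁, inner_sub_right, inner_add_right, inner_smul_right, inner_smul_right, ← hx, ← hm]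
    have : κ * (inner ℂ firstBasisVector u + z * inner ℂ firstBasisVector (R u) -
        c * inner ℂ firstBasisVector u * weylFun T₁ z) =
        c * inner ℂ firstBasisVector u + κ * (z * inner ℂ firstBasisVector (R u)) := by
      linear_combination (inner ℂ firstBasisVector u : ℂ) * hκ'
    rw [this]
    module

end IsRankOnePerturbation

/-- Serves the case of equal parameters for the second pair of operators, which no hypothesis
excludes. -/
theorem eq_opSpectrum_of_perturbation_zero {T₁ T₂ : EllTwo →ₗ.[ℂ] EllTwo}
    (h : IsRankOnePerturbation 0 T₁ T₂) : opSpectrum T₁ = opSpectrum T₂ := by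
  ext z
  refine not_iff_not.1 ⟨fun hz => h.notMem_opSpectrum hz (by simp), fun hz => ?_⟩
  exact h.symm.notMem_opSpectrum hz (by simp)

/-! ### Two spectra determine the coupling constant and the Weyl function -/

/-- A symmetric operator with cyclic first basis vector, whose spectrum is a set of isolated real
points. -/
structure IsRealDiscrete (T : EllTwo →ₗ.[ℂ] EllTwo) : Prop where
  symm : T.IsFormalAdjoint T
  cyclic : FirstVectorCyclic T
  first_mem : firstBasisVector ∈ T.domain
  nonreal : ∀ z : ℂ, z.im ≠ 0 → z ∉ opSpectrum T
  isolated : ∀ w : ℂ, ∀ᶠ z in 𝓝[≠] w, z ∉ opSpectrum T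

theorem resolv_firstBasisVector_ne_zero {T : EllTwo →ₗ.[ℂ] EllTwo} {z : ℂ}
    (hz : z ∉ opSpectrum T) : resolv T z firstBasisVector ≠ 0 := by
  intro h
  have e := apply_resolv hz firstBasisVector
  have : (⟨resolv T z firstBasisVector, resolv_mem hz _⟩ : T.domain) = 0 := Subtype.ext h
  rw [this, LinearPMap.map_zero, h, smul_zero, add_zero] at e
  exact firstBasisVector_ne_zero e.symm

/-- zR(z)x = R(z)Tx - x, and ‖R(iy)‖ ≤ 1/y. -/
theorem tendsto_smul_resolv {T : EllTwo →ₗ.[ℂ] EllTwo} (hT : T.IsFormalAdjoint T)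
    (hn : ∀ z : ℂ, z.im ≠ 0 → z ∉ opSpectrum T) {x : EllTwo} (hx : x ∈ T.domain) :
    Tendsto (fun y : ℝ => (y * Complex.I) • resolv T (y * Complex.I) x) atTop (𝓝 (-x)) := by
  have h1 : Tendsto (fun y : ℝ => resolv T (y * Complex.I) (T ⟨x, hx⟩)) atTop (𝓝 0) := by
    refine squeeze_zero_norm' (a := fun y : ℝ => ‖T ⟨x, hx⟩‖ / y) ?_
      (tendsto_const_nhds.div_atTop tendsto_id)
    filter_upwards [eventually_gt_atTop 0] with y hy
    have := norm_resolv_apply_le hT (hn (y * Complex.I) (by simpa using hy.ne')) (T ⟨x, hx⟩)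
    rw [le_div_iff₀ hy, mul_comm]
    simpa [abs_of_pos hy] using this
  have h2 := h1.sub_const x
  rw [zero_sub] at h2
  refine h2.congr' ?_
  filter_upwards [eventually_gt_atTop 0] with y hy
  rw [resolv_apply (hn (y * Complex.I) (by simpa using hy.ne'))]
  simp

namespace IsRealDiscrete

variable {T T₁ T₂ T₁' T₂' : EllTwo →ₗ.[ℂ] EllTwo} {c c' : ℝ} {z : ℂ}

theorem eventually_notMem (hT : IsRealDiscrete T) (hz : z ∉ opSpectrum T) :
    ∀ᶠ w in 𝓝 z, w ∉ opSpectrum T := by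
  filter_upwards [eventually_nhdsWithin_iff.1 (hT.isolated z)] with w hw
  rcases eq_or_ne w z with rfl | hne
  exacts [hz, hw hne]

theorem im_weylFun_ne_zero (hT : IsRealDiscrete T) (hz : z.im ≠ 0) : (weylFun T z).im ≠ 0 := by
  rw [im_weylFun hT.symm (hT.nonreal z hz)]
  exact mul_ne_zero hz (pow_ne_zero _ (norm_ne_zero_iff.2
    (resolv_firstBasisVector_ne_zero (hT.nonreal z hz))))

theorem one_add_mem_slitPlane (hT : IsRealDiscrete T) (c : ℝ) (hz : z.im ≠ 0) :
    1 + c * weylFun T z ∈ Complex.slitPlane := by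
  rcases eq_or_ne c 0 with rfl | hc
  · simp
  · refine Or.inr ?_
    simpa using ⟨hc, hT.im_weylFun_ne_zero hz⟩

theorem analyticAt (hT : IsRealDiscrete T) (hz : z ∉ opSpectrum T) :
    AnalyticAt ℂ (weylFun T) z := analyticAt_weylFun (hT.eventually_notMem hz)

theorem im_eq_zero (hT : IsRealDiscrete T) (hz : z ∈ opSpectrum T) : z.im = 0 := by
  by_contra h
  exact hT.nonreal z h hz

theorem meromorphicAt (hT : IsRealDiscrete T) (z : ℂ) : MeromorphicAt (weylFun T) z := by
  by_cases hz : z ∈ opSpectrum T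
  · have hre : ((z.re : ℝ) : ℂ) = z := Complex.ext rfl (hT.im_eq_zero hz).symm
    obtain ⟨s, hs, he, -⟩ := exists_weylFun_eq hT.symm hT.cyclic (hT.isolated (z.re : ℂ))
    rw [hre] at hs he
    refine MeromorphicAt.congr (f := fun w => (w - z)⁻¹ * s w) ?_ (he.mono fun _ h => h.symm)
    exact ((MeromorphicAt.id z).sub (MeromorphicAt.const z z)).inv.mul hs.meromorphicAt
  · exact (hT.analyticAt hz).meromorphicAt

theorem meromorphicAt_one_add (hT : IsRealDiscrete T) (c : ℝ) (z : ℂ) :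
    MeromorphicAt (fun w => 1 + c * weylFun T w) z :=
  (MeromorphicAt.const 1 z).add ((MeromorphicAt.const (c : ℂ) z).mul (hT.meromorphicAt z))

theorem meromorphicOrderAt_eq_neg_one (hT : IsRealDiscrete T) (hc : c ≠ 0)
    (hz : z ∈ opSpectrum T) : meromorphicOrderAt (fun w => 1 + c * weylFun T w) z = (-1 : ℤ) := by
  have hre : ((z.re : ℝ) : ℂ) = z := Complex.ext rfl (hT.im_eq_zero hz).symm
  obtain ⟨s, hs, he, h0⟩ := exists_weylFun_eq hT.symm hT.cyclic (hT.isolated (z.re : ℂ))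
  rw [hre] at hs he h0
  rw [meromorphicOrderAt_eq_int_iff (hT.meromorphicAt_one_add c z)]
  refine ⟨fun w => (w - z) + c * s w, by fun_prop, ?_, ?_⟩
  · simpa using ⟨hc, h0 hz⟩
  · filter_upwards [he, self_mem_nhdsWithin] with w hw hne
    have hne : w - z ≠ 0 := sub_ne_zero.2 hne
    rw [hw, zpow_neg_one, smul_eq_mul]
    field_simp

theorem perturbation (hT₁ : IsRealDiscrete T₁) (h : IsRankOnePerturbation c T₁ T₂)
    (hsymm : T₂.IsFormalAdjoint T₂) (hcyc : FirstVectorCyclic T₂) : IsRealDiscrete T₂ where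
  symm := hsymm
  cyclic := hcyc
  first_mem := h.domain_eq ▸ hT₁.first_mem
  nonreal z hz := by
    refine h.notMem_opSpectrum (hT₁.nonreal z hz) ?_
    have := Complex.slitPlane_ne_zero (hT₁.one_add_mem_slitPlane (-c) hz)
    simpa [sub_eq_add_neg] using this
  isolated w := by
    have hne : ∀ᶠ z in 𝓝[≠] w, 1 + ((-c : ℝ) : ℂ) * weylFun T₁ z ≠ 0 := by
      -- A meromorphic function has isolated zeros unless it vanishes on a punctured neighbourhood;
      -- that neighbourhood would contain nonreal points, where 1 - c m₁ is not 0.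
      rcases (hT₁.meromorphicAt_one_add (-c) w).eventually_eq_zero_or_eventually_ne_zero
        with h0 | h0
      · exfalso
        have hfreq : ∃ᶠ z : ℂ in 𝓝[≠] w, z.im ≠ 0 := by
          have : w ∈ closure ({z : ℂ | z.im ≠ 0} \ {w}) :=
            (dense_im_ne_zero.sdiff_singleton w) w
          rw [frequently_iff_neBot]
          rw [mem_closure_iff_nhdsWithin_neBot] at this
          refine this.mono ?_
          rw [Set.sdiff_eq, Set.inter_comm, nhdsWithin_inter']
        obtain ⟨z, hz, hz'⟩ := (hfreq.and_eventually h0).exists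
        exact Complex.slitPlane_ne_zero (hT₁.one_add_mem_slitPlane (-c) hz) hz'
      · exact h0
    filter_upwards [hne, hT₁.isolated w] with z hz hz'
    refine h.notMem_opSpectrum hz' ?_
    simpa [sub_eq_add_neg] using hz

theorem congr_spectrum (hT : IsRealDiscrete T) (hs : opSpectrum T = opSpectrum T₁)
    (hsymm : T₁.IsFormalAdjoint T₁) (hcyc : FirstVectorCyclic T₁)
    (hmem : firstBasisVector ∈ T₁.domain) : IsRealDiscrete T₁ where
  symm := hsymm
  cyclic := hcyc
  first_mem := hmem
  nonreal := hs ▸ hT.nonreal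
  isolated := hs ▸ hT.isolated

theorem meromorphicOrderAt_add_eq_zero (hT₁ : IsRealDiscrete T₁) (hT₂ : IsRealDiscrete T₂)
    (h : IsRankOnePerturbation c T₁ T₂) (z : ℂ) :
    meromorphicOrderAt (fun w => 1 + c * weylFun T₂ w) z +
      meromorphicOrderAt (fun w => 1 + ((-c : ℝ) : ℂ) * weylFun T₁ w) z = 0 := by
  rw [← meromorphicOrderAt_mul (hT₂.meromorphicAt_one_add _ z) (hT₁.meromorphicAt_one_add _ z)]
  have : (fun w => 1 + c * weylFun T₂ w) * (fun w => 1 + ((-c : ℝ) : ℂ) * weylFun T₁ w)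
      =ᶠ[𝓝[≠] z] fun _ => 1 := by
    filter_upwards [hT₁.isolated z, hT₂.isolated z] with w h₁ h₂
    have := h.mul_weylFun_eq_one h₁ h₂
    simpa [sub_eq_add_neg] using this
  rw [meromorphicOrderAt_congr this, meromorphicOrderAt_const]
  simp

-- The orders of 1 + c m₂ and 1 - c m₁ add up to 0. On σ(T₂) the first is -1, on σ(T₁) the second is
-- -1, and elsewhere both are nonnegative, hence 0.
open Classical in
theorem meromorphicOrderAt_eq (hT₁ : IsRealDiscrete T₁) (hT₂ : IsRealDiscrete T₂)
    (h : IsRankOnePerturbation c T₁ T₂) (hc : c ≠ 0) (z : ℂ) :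
    meromorphicOrderAt (fun w => 1 + c * weylFun T₂ w) z =
      if z ∈ opSpectrum T₂ then ((-1 : ℤ) : WithTop ℤ) else
        if z ∈ opSpectrum T₁ then ((1 : ℤ) : WithTop ℤ) else ((0 : ℤ) : WithTop ℤ) := by
  have hadd := meromorphicOrderAt_add_eq_zero hT₁ hT₂ h z
  split_ifs with h₂ h₁
  · exact hT₂.meromorphicOrderAt_eq_neg_one hc h₂
  · rw [hT₁.meromorphicOrderAt_eq_neg_one (neg_ne_zero.2 hc) h₁] at hadd
    revert hadd
    cases meromorphicOrderAt (fun w => 1 + c * weylFun T₂ w) z with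
    | top => simp
    | coe n =>
      intro hadd
      norm_cast at hadd ⊢
      omega
  · have a₁ : 0 ≤ meromorphicOrderAt (fun w => 1 + ((-c : ℝ) : ℂ) * weylFun T₁ w) z :=
      (analyticAt_const.add (analyticAt_const.mul
        (hT₁.analyticAt h₁))).meromorphicOrderAt_nonneg
    have a₂ : 0 ≤ meromorphicOrderAt (fun w => 1 + c * weylFun T₂ w) z :=
      (analyticAt_const.add (analyticAt_const.mul
        (hT₂.analyticAt h₂))).meromorphicOrderAt_nonneg
    revert hadd a₁ a₂
    cases meromorphicOrderAt (fun w => 1 + c * weylFun T₂ w) z with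
    | top => simp
    | coe n =>
      cases meromorphicOrderAt (fun w => 1 + ((-c : ℝ) : ℂ) * weylFun T₁ w) z with
      | top => simp
      | coe m =>
        intro hadd a₁ a₂
        norm_cast at hadd a₁ a₂ ⊢
        omega

theorem disjoint_opSpectrum (hT₁ : IsRealDiscrete T₁) (hT₂ : IsRealDiscrete T₂)
    (h : IsRankOnePerturbation c T₁ T₂) (hc : c ≠ 0) (h₁ : z ∈ opSpectrum T₁) :
    z ∉ opSpectrum T₂ := by
  intro h₂
  have hadd := meromorphicOrderAt_add_eq_zero hT₁ hT₂ h z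
  rw [hT₂.meromorphicOrderAt_eq_neg_one hc h₂,
    hT₁.meromorphicOrderAt_eq_neg_one (neg_ne_zero.2 hc) h₁] at hadd
  norm_cast at hadd

theorem tendsto_mul_weylFun (hT : IsRealDiscrete T) :
    Tendsto (fun y : ℝ => (y * Complex.I) * weylFun T (y * Complex.I)) atTop (𝓝 (-1)) := by
  have h1 := tendsto_smul_resolv hT.symm hT.nonreal hT.first_mem
  have h2 := ((innerSL ℂ firstBasisVector).continuous.tendsto _).comp h1
  rw [innerSL_apply_apply, inner_neg_right, inner_firstBasisVector_self] at h2
  refine h2.congr fun y => ?_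
  rw [Function.comp_apply, innerSL_apply_apply, inner_smul_right, weylFun]

theorem tendsto_weylFun (hT : IsRealDiscrete T) :
    Tendsto (fun y : ℝ => weylFun T (y * Complex.I)) atTop (𝓝 0) := by
  have h1 : Tendsto (fun y : ℝ => ((y : ℂ) * Complex.I)⁻¹) atTop (𝓝 0) := by
    rw [tendsto_zero_iff_norm_tendsto_zero]
    refine tendsto_inv_atTop_zero.congr' ?_
    filter_upwards [eventually_gt_atTop 0] with y hy
    simp [abs_of_pos hy]
  have h2 := h1.mul hT.tendsto_mul_weylFun
  rw [zero_mul] at h2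
  refine h2.congr' ?_
  filter_upwards [eventually_gt_atTop 0] with y hy
  rw [inv_mul_cancel_left₀ (mul_ne_zero (by exact_mod_cast hy.ne') Complex.I_ne_zero)]

/-- The spectra of an operator and of a rank one perturbation of it determine the coupling constant
and the Weyl functions. -/
theorem weylFun_eq_of_opSpectrum_eq (hT₁ : IsRealDiscrete T₁) (hT₂ : IsRealDiscrete T₂)
    (hT₁' : IsRealDiscrete T₁') (hT₂' : IsRealDiscrete T₂')
    (h : IsRankOnePerturbation c T₁ T₂) (h' : IsRankOnePerturbation c' T₁' T₂') (hc : c ≠ 0)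
    (hs₁ : opSpectrum T₁ = opSpectrum T₁') (hs₂ : opSpectrum T₂ = opSpectrum T₂') :
    c = c' ∧ ∀ z : ℂ, z.im ≠ 0 → weylFun T₂ z = weylFun T₂' z := by
  classical
  have hord : ∀ z, meromorphicOrderAt (fun w => 1 + c * weylFun T₂ w) z =
      meromorphicOrderAt (fun w => 1 + c' * weylFun T₂' w) z := by
    intro z
    rw [meromorphicOrderAt_eq hT₁ hT₂ h hc]
    -- If c' = 0, then σ(T₁) = σ(T₂); being disjoint, both are empty and all orders are 0, as for
    -- the constant 1. The asymptotics below still give c = c'.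
    rcases eq_or_ne c' 0 with rfl | hc'
    · have e : opSpectrum T₁ = opSpectrum T₂ := by
        rw [hs₁, hs₂]
        exact eq_opSpectrum_of_perturbation_zero h'
      have h₁ : z ∉ opSpectrum T₁ := fun hz =>
        disjoint_opSpectrum hT₁ hT₂ h hc hz (e ▸ hz)
      rw [if_neg (e ▸ h₁), if_neg h₁]
      simp [meromorphicOrderAt_const]
    · rw [meromorphicOrderAt_eq hT₁' hT₂' h' hc', hs₁, hs₂]
  obtain ⟨k, hk⟩ := exists_eq_const_mul_of_meromorphicOrderAt_eq
    (hT₂.meromorphicAt_one_add c) (hT₂'.meromorphicAt_one_add c') hord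
    (fun z hz => analyticAt_const.add (analyticAt_const.mul (hT₂.analyticAt (hT₂.nonreal z hz))))
    (fun z hz => analyticAt_const.add (analyticAt_const.mul (hT₂'.analyticAt (hT₂'.nonreal z hz))))
    (fun z hz => hT₂.one_add_mem_slitPlane c hz) (fun z hz => hT₂'.one_add_mem_slitPlane c' hz)
  have hy : ∀ᶠ y : ℝ in atTop, ((y : ℂ) * Complex.I).im ≠ 0 := by
    filter_upwards [eventually_gt_atTop 0] with y hy
    simpa using hy.ne'
  have hk1 : k = 1 := by
    have l₁ := (hT₂.tendsto_weylFun.const_mul (c : ℂ)).const_add 1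
    have l₂ := ((hT₂'.tendsto_weylFun.const_mul (c' : ℂ)).const_add 1).const_mul k
    have := tendsto_nhds_unique (l₁.congr' (hy.mono fun y h => hk _ h)) l₂
    simpa using this.symm
  have hm : ∀ z : ℂ, z.im ≠ 0 → (c : ℂ) * weylFun T₂ z = c' * weylFun T₂' z := by
    intro z hz
    have := hk z hz
    rw [hk1, one_mul] at this
    exact add_left_cancel this
  have hcc : c = c' := by
    have l₁ := hT₂.tendsto_mul_weylFun.const_mul (c : ℂ)
    have l₂ := hT₂'.tendsto_mul_weylFun.const_mul (c' : ℂ)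
    have := tendsto_nhds_unique (l₁.congr' (hy.mono fun y h => ?_)) l₂
    · simpa using this
    · linear_combination (y * Complex.I) * hm _ h
  refine ⟨hcc, fun z hz => ?_⟩
  have := hm z hz
  rw [← hcc] at this
  exact mul_left_cancel₀ (Complex.ofReal_ne_zero.2 hc) this

end IsRealDiscrete

/-! ### Green's formula, the adjoint and deficiency vectors -/

/-- The canonical basis of `ℓ²(ℕ)`. -/
def basisVec (k : ℕ) : EllTwo := lp.single 2 k (1 : ℂ)

theorem basisVec_zero : basisVec 0 = firstBasisVector := rfl

theorem basisVec_apply (k j : ℕ) : (basisVec k : ℕ → ℂ) j = if j = k then 1 else 0 := by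
  rw [basisVec, lp.coeFn_single]
  simp [Pi.single_apply]

theorem inner_basisVec_left (k : ℕ) (x : EllTwo) : inner ℂ (basisVec k) x = x k := by
  rw [basisVec, lp.inner_single_left]
  simp

theorem hasSum_conj_mul (u f : EllTwo) :
    HasSum (fun k => (starRingEnd ℂ) (u k) * f k) (inner ℂ u f) := by
  refine (lp.hasSum_inner u f).congr_fun fun k => ?_
  rw [RCLike.inner_apply, mul_comm]

theorem basisVec_mem_finSeq (k : ℕ) : basisVec k ∈ finSeq := by
  refine (Set.finite_singleton k).subset fun j hj => ?_
  by_contra h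
  exact hj ((basisVec_apply k j).trans (if_neg h))

theorem eq_zero_of_inner_basisVec {x : EllTwo} (h : ∀ k, inner ℂ (basisVec k) x = (0 : ℂ)) :
    x = 0 := by
  ext k
  rw [← inner_basisVec_left, h]
  rfl

theorem dense_of_basisVec_mem {K : Submodule ℂ EllTwo} (h : ∀ k, basisVec k ∈ K) :
    Dense (K : Set EllTwo) := by
  rw [Submodule.dense_iff_topologicalClosure_eq_top,
    Submodule.topologicalClosure_eq_top_iff, Submodule.eq_bot_iff]
  exact fun x hx => eq_zero_of_inner_basisVec fun k => hx _ (h k)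

/-- u - iTu and u + iTu satisfy the eigenvalue equations for i and -i, and their sum is 2u. -/
theorem eq_zero_of_sq_eq_neg {T : EllTwo →ₗ.[ℂ] EllTwo}
    (h₁ : ∀ u : T.domain, T u = Complex.I • (u : EllTwo) → (u : EllTwo) = 0)
    (h₂ : ∀ u : T.domain, T u = (-Complex.I) • (u : EllTwo) → (u : EllTwo) = 0)
    (u w : T.domain) (hu : T u = w) (hw : T w = -(u : EllTwo)) : (u : EllTwo) = 0 := by
  have e₁ := h₁ (u - Complex.I • w) (by
    rw [LinearPMap.map_sub, LinearPMap.map_smul, hw, hu, Submodule.coe_sub, Submodule.coe_smul,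
      smul_sub, smul_smul, Complex.I_mul_I, smul_neg, neg_smul, one_smul]
    abel)
  have e₂ := h₂ (u + Complex.I • w) (by
    rw [LinearPMap.map_add, LinearPMap.map_smul, hw, hu, Submodule.coe_add, Submodule.coe_smul,
      smul_add, smul_smul, neg_mul, Complex.I_mul_I, smul_neg, neg_smul, neg_neg, one_smul]
    abel)
  rw [Submodule.coe_sub, Submodule.coe_smul] at e₁
  rw [Submodule.coe_add, Submodule.coe_smul] at e₂
  have e₃ : (2 : ℂ) • (u : EllTwo) = 0 := by
    rw [two_smul]
    nth_rewrite 1 [sub_eq_zero.1 e₁]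
    rw [add_comm]
    exact e₂
  exact (smul_eq_zero.1 e₃).resolve_left two_ne_zero

namespace JacobiMatrix

variable (A : JacobiMatrix)

/-- Solutions of the difference equation are determined by their initial value. -/
theorem eq_of_diffExpr_sub_eq {z : ℂ} {f g : ℕ → ℂ}
    (h : ∀ k, A.diffExpr f k - z * f k = A.diffExpr g k - z * g k) (h0 : f 0 = g 0) : f = g := by
  have key : ∀ k, f k = g k ∧ f (k + 1) = g (k + 1) := by
    intro k
    induction k with
    | zero =>
      refine ⟨h0, ?_⟩
      have e := h 0
      simp only [diffExpr, h0] at e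
      have hb : (A.b 0 : ℂ) ≠ 0 := Complex.ofReal_ne_zero.2 (A.b_pos 0).ne'
      refine mul_left_cancel₀ hb ?_
      linear_combination e
    | succ k ih =>
      refine ⟨ih.2, ?_⟩
      have e := h (k + 1)
      simp only [diffExpr, ih.1, ih.2] at e
      have hb : (A.b (k + 1) : ℂ) ≠ 0 := Complex.ofReal_ne_zero.2 (A.b_pos (k + 1)).ne'
      refine mul_left_cancel₀ hb ?_
      linear_combination e
  exact funext fun k => (key k).1

theorem wronskian_zero_eq (u f : ℕ → ℂ) :
    A.wronskian u f 0 = u 0 * A.diffExpr f 0 - A.diffExpr u 0 * f 0 := by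
  simp only [wronskian, diffExpr]
  ring

theorem wronskian_succ (u f : ℕ → ℂ) (n : ℕ) :
    A.wronskian u f (n + 1) = A.wronskian u f n +
      (u (n + 1) * A.diffExpr f (n + 1) - A.diffExpr u (n + 1) * f (n + 1)) := by
  simp only [wronskian, diffExpr]
  ring

/-- Green's formula. -/
theorem sum_eq_wronskian (u f : ℕ → ℂ) (n : ℕ) :
    ∑ k ∈ Finset.range (n + 1), (u k * A.diffExpr f k - A.diffExpr u k * f k) =
      A.wronskian u f n := by
  induction n with
  | zero => simp [wronskian_zero_eq]
  | succ n ih => rw [Finset.sum_range_succ, ih, wronskian_succ]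

/-- The Plücker relation for the four plane vectors (x n, x (n + 1)), and so on. -/
theorem wronskian_mul_wronskian (x y u v : ℕ → ℂ) (n : ℕ) :
    A.wronskian x y n * A.wronskian u v n = A.wronskian u x n * A.wronskian v y n -
      A.wronskian v x n * A.wronskian u y n := by
  simp only [wronskian]
  ring

theorem diffExpr_conj (f : ℕ → ℂ) (k : ℕ) :
    A.diffExpr (fun j => (starRingEnd ℂ) (f j)) k = (starRingEnd ℂ) (A.diffExpr f k) := by
  cases k <;> simp [diffExpr]

theorem wronskian_conj (u f : ℕ → ℂ) (k : ℕ) :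
    A.wronskian (fun j => (starRingEnd ℂ) (u j)) (fun j => (starRingEnd ℂ) (f j)) k =
      (starRingEnd ℂ) (A.wronskian u f k) := by
  simp [wronskian]

/-- Green's formula in the limit: symmetry becomes the vanishing of a Wronskian at infinity. -/
theorem tendsto_wronskian {u f U F : EllTwo} (hu : ∀ k, A.diffExpr u k = U k)
    (hf : ∀ k, A.diffExpr f k = F k) :
    Tendsto (A.wronskian (fun j => (starRingEnd ℂ) (u j)) f) atTop
      (𝓝 (inner ℂ u F - inner ℂ U f)) := by
  have h := ((hasSum_conj_mul u F).sub (hasSum_conj_mul U f)).tendsto_sum_nat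
  have h' := (tendsto_add_atTop_iff_nat 1).2 h
  refine h'.congr fun n => ?_
  rw [← sum_eq_wronskian]
  refine Finset.sum_congr rfl fun k _ => ?_
  rw [diffExpr_conj, hu, hf]

theorem minimalOp_symm : A.minimalOp.IsFormalAdjoint A.minimalOp := by
  intro x y
  have h := A.tendsto_wronskian (u := x) (f := y) (U := A.minimalOp x) (F := A.minimalOp y)
    (fun _ => rfl) (fun _ => rfl)
  have h0 : Tendsto (A.wronskian (fun j => (starRingEnd ℂ) ((x : EllTwo) j)) (y : EllTwo)) atTop
      (𝓝 0) := by
    obtain ⟨N, hN⟩ := (show (Function.support ((y : EllTwo) : ℕ → ℂ)).Finite from y.2).bddAbove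
    have hz : ∀ m, N < m → (y : EllTwo) m = 0 := by
      intro m hm
      by_contra h
      exact absurd (hN h) (not_le.mpr hm)
    refine tendsto_const_nhds.congr' ?_
    filter_upwards [eventually_gt_atTop N] with n hn
    simp [wronskian, hz n hn, hz (n + 1) (by omega)]
  exact (sub_eq_zero.1 (tendsto_nhds_unique h h0)).symm

theorem dense_minimalOp_domain : Dense (A.minimalOp.domain : Set EllTwo) :=
  dense_of_basisVec_mem basisVec_mem_finSeq

theorem minimalOp_isClosable : A.minimalOp.IsClosable :=
  (LinearPMap.adjoint_isClosed A.dense_minimalOp_domain).isClosable.leIsClosable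
    (LinearPMap.IsFormalAdjoint.le_adjoint A.dense_minimalOp_domain A.minimalOp_symm)

theorem minimalOp_le_op : A.minimalOp ≤ A.op := A.minimalOp.le_closure

theorem op_isClosed : A.op.IsClosed := A.minimalOp_isClosable.closure_isClosed

theorem basisVec_mem_op (k : ℕ) : basisVec k ∈ A.op.domain :=
  A.minimalOp_le_op.1 (basisVec_mem_finSeq k)

theorem dense_op_domain : Dense (A.op.domain : Set EllTwo) :=
  dense_of_basisVec_mem A.basisVec_mem_op

theorem op_basisVec (k : ℕ) (h : basisVec k ∈ A.op.domain) (j : ℕ) :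
    A.op ⟨basisVec k, h⟩ j = A.diffExpr (basisVec k) j := by
  rw [← A.minimalOp_le_op.2 (x := ⟨basisVec k, basisVec_mem_finSeq k⟩) (y := ⟨basisVec k, h⟩) rfl]
  rfl

/-- An identity with the minimal operator passes to its closure. -/
theorem inner_op_of_minimalOp {u w : EllTwo}
    (h : ∀ x : A.minimalOp.domain, inner ℂ w (x : EllTwo) = (inner ℂ u (A.minimalOp x) : ℂ))
    (x : A.op.domain) : inner ℂ w (x : EllTwo) = (inner ℂ u (A.op x) : ℂ) := by
  have hx : ((x : EllTwo), A.op x) ∈ A.minimalOp.graph.topologicalClosure := by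
    rw [A.minimalOp_isClosable.graph_closure_eq_closure_graph]
    exact A.op.mem_graph x
  have hcl : IsClosed {p : EllTwo × EllTwo | inner ℂ w p.1 = (inner ℂ u p.2 : ℂ)} :=
    isClosed_eq (by fun_prop) (by fun_prop)
  refine closure_minimal ?_ hcl hx
  rintro ⟨p, q⟩ hp
  obtain ⟨y, rfl, rfl⟩ := (LinearPMap.mem_graph_iff _).1 hp
  exact h y

theorem op_symm : A.op.IsFormalAdjoint A.op := by
  intro x y
  refine A.inner_op_of_minimalOp (fun y => ?_) y
  have := A.inner_op_of_minimalOp (u := y) (w := A.minimalOp y) (fun v => A.minimalOp_symm y v) x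
  rw [← inner_conj_symm, ← this, inner_conj_symm]

theorem op_le_adjoint : A.op ≤ A.op.adjoint :=
  LinearPMap.IsFormalAdjoint.le_adjoint A.dense_op_domain A.op_symm

/-- Column k of the matrix vanishes beyond k + 1, so the inner product is a finite sum and Green's
formula has no boundary term. It follows that J* acts by the difference expression. -/
theorem diffExpr_basisVec_inner (f : EllTwo) (k : ℕ) (h : basisVec k ∈ A.op.domain) :
    inner ℂ (A.op ⟨basisVec k, h⟩) f = A.diffExpr f k := by
  have hk : ∀ j, j ∉ Finset.range (k + 2) → (inner ℂ (A.op ⟨basisVec k, h⟩ j) (f j) : ℂ) = 0 := by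
    intro j hj
    have hj : k + 2 ≤ j := by simpa using hj
    obtain ⟨i, rfl⟩ : ∃ i, j = i + 1 := ⟨j - 1, by omega⟩
    rw [op_basisVec]
    simp only [diffExpr, basisVec_apply]
    rw [if_neg (by omega), if_neg (by omega), if_neg (by omega)]
    simp
  rw [(lp.hasSum_inner _ _).unique (hasSum_sum_of_ne_finset_zero hk)]
  have hG := A.sum_eq_wronskian (basisVec k) f (k + 1)
  have hW : A.wronskian (basisVec k) f (k + 1) = 0 := by
    have h2 : k + 1 + 1 ≠ k := by omega
    simp [wronskian, basisVec_apply, h2]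
  rw [hW, Finset.sum_sub_distrib, sub_eq_zero] at hG
  have e : ∑ j ∈ Finset.range (k + 1 + 1), (basisVec k : ℕ → ℂ) j * A.diffExpr f j =
      A.diffExpr f k := by
    rw [Finset.sum_eq_single k]
    · simp [basisVec_apply]
    · intro j _ hj
      simp [basisVec_apply, hj]
    · intro hk
      exact absurd (Finset.mem_range.2 (by omega)) hk
  rw [← e, hG]
  refine Finset.sum_congr rfl fun j _ => ?_
  rw [op_basisVec, RCLike.inner_apply, ← diffExpr_conj]
  have : (fun i => (starRingEnd ℂ) ((basisVec k : ℕ → ℂ) i)) = basisVec k := by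
    funext i
    rw [basisVec_apply]
    split_ifs <;> simp
  rw [this, mul_comm]

theorem adjoint_apply (x : A.op.adjoint.domain) (k : ℕ) :
    A.op.adjoint x k = A.diffExpr (x : EllTwo) k := by
  have h := LinearPMap.adjoint_isFormalAdjoint A.dense_op_domain x ⟨_, A.basisVec_mem_op k⟩
  rw [← inner_conj_symm, ← inner_conj_symm (x : EllTwo), inner_basisVec_left,
    diffExpr_basisVec_inner] at h
  exact (starRingEnd ℂ).injective h

/-- If `J ≠ J*`, then `J*` has an eigenvector for one of `±i`. -/
theorem exists_eigenvector (h : ¬ IsSelfAdjoint A.op) :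
    ∃ z : ℂ, z.im ≠ 0 ∧ ∃ u : A.op.adjoint.domain, (u : EllTwo) ≠ 0 ∧
      A.op.adjoint u = z • (u : EllTwo) := by
  by_contra! hcon
  refine h ?_
  rw [LinearPMap.isSelfAdjoint_def]
  refine le_antisymm ?_ A.op_le_adjoint
  set T := A.op.adjoint with hT
  -- The graph of J is placed in the Hilbert sum, where a point of the graph of J* can be projected
  -- onto it. The orthogonal part (u, J*u) satisfies J*J*u = -u.
  let L := WithLp.linearEquiv 2 ℂ (EllTwo × EllTwo)
  let K : Submodule ℂ (WithLp 2 (EllTwo × EllTwo)) := A.op.graph.map L.symm.toLinearMap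
  have hK : IsClosed (K : Set (WithLp 2 (EllTwo × EllTwo))) := by
    have : (K : Set (WithLp 2 (EllTwo × EllTwo))) = L ⁻¹' (A.op.graph : Set (EllTwo × EllTwo)) := by
      simp only [K, Submodule.map_coe]
      rw [LinearEquiv.coe_coe, LinearEquiv.image_eq_preimage_symm]
      rfl
    rw [this]
    exact A.op_isClosed.preimage (WithLp.prod_continuous_ofLp _ _ _)
  have : CompleteSpace K := hK.completeSpace_coe
  have hzero : ∀ z : ℂ, z.im ≠ 0 → ∀ u : T.domain, T u = z • (u : EllTwo) → (u : EllTwo) = 0 := by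
    intro z hz u hu
    by_contra h0
    exact hcon z hz u h0 hu
  have hdom : ∀ f : T.domain, (f : EllTwo) ∈ A.op.domain := by
    intro f
    obtain ⟨p, hp, r, hr, hfr⟩ := K.exists_add_mem_mem_orthogonal (L.symm ((f : EllTwo), T f))
    obtain ⟨⟨x, y⟩, hx, rfl⟩ := hp
    obtain ⟨x, rfl, rfl⟩ := (LinearPMap.mem_graph_iff _).1 hx
    have hxT := A.op_le_adjoint.1 x.2
    have hxe : A.op x = T ⟨x, hxT⟩ := A.op_le_adjoint.2 rfl
    set u : T.domain := f - ⟨x, hxT⟩ with hu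
    have hru : r = L.symm ((u : EllTwo), T u) := by
      rw [← sub_eq_iff_eq_add'.2 hfr, hu, LinearPMap.map_sub, ← hxe]
      rfl
    have horth : ∀ y : A.op.domain,
        (inner ℂ (y : EllTwo) (u : EllTwo) : ℂ) + inner ℂ (A.op y) (T u) = 0 := by
      intro y
      have := hr (L.symm ((y : EllTwo), A.op y))
        (Submodule.mem_map_of_mem (A.op.mem_graph y))
      rw [hru] at this
      simpa [L, WithLp.prod_inner_apply] using this
    have hw : ∀ y : A.op.domain, inner ℂ (-(u : EllTwo)) (y : EllTwo) =
        (inner ℂ (T u) (A.op y) : ℂ) := by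
      intro y
      have := congrArg (starRingEnd ℂ) (horth y)
      rw [map_add, inner_conj_symm, inner_conj_symm, map_zero] at this
      rw [inner_neg_left]
      linear_combination -this
    have hwT : T u ∈ T.domain := LinearPMap.mem_adjoint_domain_of_exists _ ⟨_, hw⟩
    have hwe : T ⟨T u, hwT⟩ = -(u : EllTwo) :=
      LinearPMap.adjoint_apply_eq A.dense_op_domain ⟨T u, hwT⟩ hw
    have h3 : (u : EllTwo) = 0 := eq_zero_of_sq_eq_neg (hzero _ (by simp)) (hzero _ (by simp))
      u ⟨T u, hwT⟩ rfl hwe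
    have h5 : (f : EllTwo) = x := by
      rw [hu] at h3
      exact sub_eq_zero.1 h3
    rw [h5]
    exact x.2
  refine ⟨fun f hf => hdom ⟨f, hf⟩, fun x y hxy => ?_⟩
  exact (A.op_le_adjoint.2 hxy.symm).symm

end JacobiMatrix

/-! ### Orthogonal polynomials and square summable solutions -/

namespace JacobiMatrix

variable (A : JacobiMatrix)

theorem b_ne_zero (n : ℕ) : (A.b n : ℂ) ≠ 0 := Complex.ofReal_ne_zero.2 (A.b_pos n).ne'

theorem diffExpr_polyP (z : ℂ) (k : ℕ) : A.diffExpr (A.polyP z) k = z * A.polyP z k := by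
  have h0 := A.b_ne_zero 0
  cases k with
  | zero =>
    simp only [diffExpr, polyP]
    field_simp
    ring
  | succ k =>
    have h1 := A.b_ne_zero (k + 1)
    simp only [diffExpr, polyP]
    field_simp
    ring

theorem diffExpr_polyQ (z : ℂ) (k : ℕ) :
    A.diffExpr (A.polyQ z) k = z * A.polyQ z k + if k = 0 then 1 else 0 := by
  have h0 := A.b_ne_zero 0
  cases k with
  | zero =>
    simp only [diffExpr, polyQ]
    field_simp
    simp
  | succ k =>
    have h1 := A.b_ne_zero (k + 1)
    rw [if_neg (Nat.succ_ne_zero k)]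
    simp only [diffExpr, polyQ]
    field_simp
    ring

theorem diffExpr_linear (a c : ℂ) (f g : ℕ → ℂ) (k : ℕ) :
    A.diffExpr (fun j => a * f j + c * g j) k = a * A.diffExpr f k + c * A.diffExpr g k := by
  cases k <;> simp only [diffExpr] <;> ring

/-- Every solution of the inhomogeneous equation is a combination of the polynomials. -/
theorem eq_polyP_add_polyQ {z a : ℂ} {f : ℕ → ℂ}
    (h : ∀ k, A.diffExpr f k = z * f k + if k = 0 then a else 0) :
    f = fun j => f 0 * A.polyP z j + a * A.polyQ z j := by
  refine A.eq_of_diffExpr_sub_eq (z := z) (fun k => ?_) ?_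
  · rw [diffExpr_linear, h, diffExpr_polyP, diffExpr_polyQ]
    split_ifs <;> ring
  · simp [polyP, polyQ]

theorem polyP_conj (z : ℂ) :
    (fun j => (starRingEnd ℂ) (A.polyP z j)) = A.polyP ((starRingEnd ℂ) z) := by
  refine A.eq_of_diffExpr_sub_eq (z := (starRingEnd ℂ) z) (fun k => ?_) (by simp [polyP])
  rw [diffExpr_conj, diffExpr_polyP, diffExpr_polyP, map_mul, sub_self, sub_self]

theorem polyQ_conj (z : ℂ) :
    (fun j => (starRingEnd ℂ) (A.polyQ z j)) = A.polyQ ((starRingEnd ℂ) z) := by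
  refine A.eq_of_diffExpr_sub_eq (z := (starRingEnd ℂ) z) (fun k => ?_) (by simp [polyQ])
  rw [diffExpr_conj, diffExpr_polyQ, diffExpr_polyQ, map_add, map_mul]
  split_ifs <;> simp

theorem wronskian_polyP_of_diffExpr {z : ℂ} {f : ℕ → ℂ}
    (h : ∀ k, A.diffExpr f k = z * f k + if k = 0 then 1 else 0) (n : ℕ) :
    A.wronskian (A.polyP z) f n = 1 := by
  rw [← sum_eq_wronskian, Finset.sum_eq_single 0]
  · rw [h, diffExpr_polyP, polyP, if_pos rfl]
    ring
  · intro k _ hk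
    rw [h, diffExpr_polyP, if_neg hk]
    ring
  · simp

theorem wronskian_polyP_polyQ (z : ℂ) (n : ℕ) :
    A.wronskian (A.polyP z) (A.polyQ z) n = 1 :=
  A.wronskian_polyP_of_diffExpr (A.diffExpr_polyQ z) n

section Weyl

/-- Green's formula for conj f and f; the boundary term contains f (n + 1) = 0. -/
theorem im_sum_eq {z : ℂ} {f : ℕ → ℂ} {a : ℝ}
    (h : ∀ k, A.diffExpr f k = z * f k + if k = 0 then (a : ℂ) else 0) {n : ℕ}
    (hn : f (n + 1) = 0) :
    z.im * ∑ k ∈ Finset.range (n + 1), ‖f k‖ ^ 2 = a * (f 0).im := by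
  have hG := A.sum_eq_wronskian (fun j => (starRingEnd ℂ) (f j)) f n
  have hW : A.wronskian (fun j => (starRingEnd ℂ) (f j)) f n = 0 := by
    simp [wronskian, hn]
  rw [hW] at hG
  have hterm : ∀ k, (starRingEnd ℂ) (f k) * A.diffExpr f k -
      A.diffExpr (fun j => (starRingEnd ℂ) (f j)) k * f k =
      ((2 * (z.im * ‖f k‖ ^ 2) : ℝ) : ℂ) * Complex.I +
        if k = 0 then -((2 * (a * (f 0).im) : ℝ) : ℂ) * Complex.I else 0 := by
    intro k
    rw [diffExpr_conj, h]
    have h1 : ((‖f k‖ ^ 2 : ℝ) : ℂ) = f k * (starRingEnd ℂ) (f k) := by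
      rw [Complex.mul_conj, Complex.normSq_eq_norm_sq]
    have h2 : z - (starRingEnd ℂ) z = ((2 * z.im : ℝ) : ℂ) * Complex.I := Complex.sub_conj z
    have h3 : f 0 - (starRingEnd ℂ) (f 0) = ((2 * (f 0).im : ℝ) : ℂ) * Complex.I :=
      Complex.sub_conj (f 0)
    rw [← mul_assoc, Complex.ofReal_mul, h1, map_add, map_mul]
    split_ifs with hk
    · subst hk
      rw [Complex.conj_ofReal]
      push_cast at h2 h3 ⊢
      linear_combination (f 0 * (starRingEnd ℂ) (f 0)) * h2 - a * h3
    · rw [map_zero]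
      push_cast at h2 ⊢
      linear_combination (f k * (starRingEnd ℂ) (f k)) * h2
  simp only [hterm, Finset.sum_add_distrib, Finset.sum_ite_eq', ← Finset.sum_mul] at hG
  rw [if_pos (by simp), ← add_mul] at hG
  have h4 := (mul_eq_zero.1 hG).resolve_right Complex.I_ne_zero
  have h5 : ∑ k ∈ Finset.range (n + 1), 2 * (z.im * ‖f k‖ ^ 2) - 2 * (a * (f 0).im) = 0 := by
    have : ((∑ k ∈ Finset.range (n + 1), 2 * (z.im * ‖f k‖ ^ 2) - 2 * (a * (f 0).im) : ℝ) : ℂ)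
        = 0 := by
      rw [Complex.ofReal_sub, Complex.ofReal_sum, sub_eq_add_neg]
      exact h4
    exact_mod_cast this
  rw [← Finset.mul_sum, ← Finset.mul_sum] at h5
  linarith

theorem polyP_ne_zero {z : ℂ} (hz : z.im ≠ 0) (n : ℕ) : A.polyP z (n + 1) ≠ 0 := by
  intro h
  have h1 := A.im_sum_eq (z := z) (f := A.polyP z) (a := 0)
    (fun k => by rw [diffExpr_polyP]; simp) h
  rw [zero_mul] at h1
  have h2 := (mul_eq_zero.1 h1).resolve_left hz
  have h3 := (Finset.sum_eq_zero_iff_of_nonneg fun k _ => sq_nonneg _).1 h2 0 (by simp)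
  simp [polyP] at h3

/-- The Weyl solution: for nonreal `z` some solution of the inhomogeneous equation is square
summable. -/
theorem exists_summable_weyl {z : ℂ} (hz : z.im ≠ 0) :
    ∃ t : ℂ, Summable fun k => ‖t * A.polyP z k + A.polyQ z k‖ ^ 2 := by
  set M : ℝ := 1 / |z.im| with hM
  have hzp : 0 < |z.im| := abs_pos.2 hz
  have hM0 : 0 < M := by positivity
  -- Chosen so that f = tP + Q vanishes at n + 1. Then |t|² ≤ ∑|f k|² = Im t / Im z ≤ M|t|, which
  -- bounds both t and the sum uniformly in n; a limit point of t gives the Weyl solution.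
  let t : ℕ → ℂ := fun n => -(A.polyQ z (n + 1) / A.polyP z (n + 1))
  have hkey : ∀ n, ‖t n‖ ≤ M ∧
      ∑ k ∈ Finset.range (n + 1), ‖t n * A.polyP z k + A.polyQ z k‖ ^ 2 ≤ M ^ 2 := by
    intro n
    set f : ℕ → ℂ := fun k => t n * A.polyP z k + 1 * A.polyQ z k with hf
    have hf0 : f 0 = t n := by simp [hf, polyP, polyQ]
    have hfn : f (n + 1) = 0 := by
      have := A.polyP_ne_zero hz n
      simp only [hf, t]
      field_simp
      ring
    have h1 := A.im_sum_eq (z := z) (f := f) (a := 1) (fun k => by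
      rw [hf, diffExpr_linear, diffExpr_polyP, diffExpr_polyQ]
      split_ifs <;> push_cast <;> ring) hfn
    rw [one_mul, hf0] at h1
    set S := ∑ k ∈ Finset.range (n + 1), ‖f k‖ ^ 2 with hS
    have hS0 : 0 ≤ S := Finset.sum_nonneg fun k _ => sq_nonneg _
    have h2 : |z.im| * S ≤ ‖t n‖ := by
      rw [← abs_of_nonneg hS0, ← abs_mul, h1]
      exact Complex.abs_im_le_norm _
    have h3 : ‖t n‖ ^ 2 ≤ S := by
      rw [← hf0]
      exact Finset.single_le_sum (f := fun k => ‖f k‖ ^ 2) (fun k _ => sq_nonneg _) (by simp)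
    have h4 : ‖t n‖ ≤ M := by
      rw [hM, le_div_iff₀ hzp]
      by_contra! hlt
      have ht : 0 < ‖t n‖ := by
        by_contra! h0
        nlinarith
      nlinarith [mul_le_mul_of_nonneg_left h3 hzp.le, mul_lt_mul_of_pos_left hlt ht]
    refine ⟨h4, ?_⟩
    have h5 : S ≤ M ^ 2 := by
      have : S ≤ ‖t n‖ * M := by
        rw [hM, mul_one_div, le_div_iff₀ hzp]
        linarith
      nlinarith
    simpa [hS, hf] using h5
  obtain ⟨t₀, -, φ, hφ, hlim⟩ := (isCompact_closedBall (0 : ℂ) M).tendsto_subseq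
    (x := t) (fun n => by simpa using (hkey n).1)
  refine ⟨t₀, summable_of_sum_range_le (c := M ^ 2) (fun k => sq_nonneg _) fun N => ?_⟩
  have hl : Tendsto (fun n => ∑ k ∈ Finset.range N,
      ‖t (φ n) * A.polyP z k + A.polyQ z k‖ ^ 2) atTop
      (𝓝 (∑ k ∈ Finset.range N, ‖t₀ * A.polyP z k + A.polyQ z k‖ ^ 2)) :=
    tendsto_finsetSum _ fun k _ => (((hlim.mul_const _).add_const _).norm.pow 2)
  refine le_of_tendsto hl ?_
  filter_upwards [eventually_ge_atTop N] with n hn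
  refine le_trans ?_ (hkey (φ n)).2
  refine Finset.sum_le_sum_of_subset_of_nonneg ?_ fun k _ _ => sq_nonneg _
  intro k hk
  have := hφ.id_le n
  simp only [Finset.mem_range, id] at *
  omega

end Weyl

/-- Variation of constants: if all solutions at `z` are square summable, then so are those
at every `w`. -/
theorem summable_of_summable {z w a : ℂ} (hP : Summable fun k => ‖A.polyP z k‖ ^ 2)
    (hQ : Summable fun k => ‖A.polyQ z k‖ ^ 2) {u : ℕ → ℂ}
    (hu : ∀ k, A.diffExpr u k = w * u k + if k = 0 then a else 0) :
    Summable fun k => ‖u k‖ ^ 2 := by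
  set d : ℕ → ℝ := fun k => ‖A.polyP z k‖ + ‖A.polyQ z k‖ with hd
  have hd0 : ∀ k, 0 ≤ d k := fun k => by positivity
  have hdsum : Summable fun k => d k ^ 2 := by
    refine Summable.of_nonneg_of_le (fun k => sq_nonneg _) (fun k => ?_)
      ((hP.add hQ).mul_left 2)
    simp only [hd]
    nlinarith [sq_nonneg (‖A.polyP z k‖ - ‖A.polyQ z k‖)]
  -- The two Wronskians are the coefficients of u (n + 1) in terms of P and Q. Each step changes
  -- them by (w - z)u times Q or P, so a discrete Gronwall estimate with ∑ d² finite bounds them.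
  set s : ℕ → ℝ := fun n => ‖A.wronskian u (A.polyQ z) n‖ + ‖A.wronskian (A.polyP z) u n‖ with hs
  have hs0 : ∀ n, 0 ≤ s n := fun n => by positivity
  have hu1 : ∀ n, ‖u (n + 1)‖ ≤ d (n + 1) * s n := by
    intro n
    have e : u (n + 1) = A.polyP z (n + 1) * A.wronskian u (A.polyQ z) n +
        A.polyQ z (n + 1) * A.wronskian (A.polyP z) u n := by
      have h := A.wronskian_polyP_polyQ z n
      rw [← mul_one (u (n + 1)), ← h]
      simp only [wronskian]
      ring
    rw [e]
    refine (norm_add_le _ _).trans ?_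
    rw [norm_mul, norm_mul]
    simp only [hd, hs]
    nlinarith [norm_nonneg (A.polyP z (n + 1)), norm_nonneg (A.polyQ z (n + 1)),
      norm_nonneg (A.wronskian u (A.polyQ z) n), norm_nonneg (A.wronskian (A.polyP z) u n),
      mul_nonneg (norm_nonneg (A.polyP z (n + 1))) (norm_nonneg (A.wronskian (A.polyP z) u n)),
      mul_nonneg (norm_nonneg (A.polyQ z (n + 1))) (norm_nonneg (A.wronskian u (A.polyQ z) n))]
  have hstep : ∀ n, s (n + 1) ≤ s n * (1 + ‖w - z‖ * d (n + 1) ^ 2) := by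
    intro n
    have e1 : A.wronskian u (A.polyQ z) (n + 1) =
        A.wronskian u (A.polyQ z) n - (w - z) * (u (n + 1) * A.polyQ z (n + 1)) := by
      rw [wronskian_succ, hu, diffExpr_polyQ]
      simp only [Nat.add_eq_zero_iff, one_ne_zero, and_false, if_false]
      ring
    have e2 : A.wronskian (A.polyP z) u (n + 1) =
        A.wronskian (A.polyP z) u n + (w - z) * (u (n + 1) * A.polyP z (n + 1)) := by
      rw [wronskian_succ, hu, diffExpr_polyP]
      simp only [Nat.add_eq_zero_iff, one_ne_zero, and_false, if_false]
      ring
    have n1 : ‖A.wronskian u (A.polyQ z) (n + 1)‖ ≤ ‖A.wronskian u (A.polyQ z) n‖ +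
        ‖w - z‖ * (‖u (n + 1)‖ * ‖A.polyQ z (n + 1)‖) := by
      rw [e1]
      refine (norm_sub_le _ _).trans ?_
      rw [norm_mul, norm_mul]
    have n2 : ‖A.wronskian (A.polyP z) u (n + 1)‖ ≤ ‖A.wronskian (A.polyP z) u n‖ +
        ‖w - z‖ * (‖u (n + 1)‖ * ‖A.polyP z (n + 1)‖) := by
      rw [e2]
      refine (norm_add_le _ _).trans ?_
      rw [norm_mul, norm_mul]
    have h1 : ‖w - z‖ * (‖u (n + 1)‖ * d (n + 1)) ≤ ‖w - z‖ * (d (n + 1) * s n * d (n + 1)) := by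
      gcongr
      exact hu1 n
    calc s (n + 1) ≤ s n + ‖w - z‖ * (‖u (n + 1)‖ * d (n + 1)) := by
          simp only [hs, hd] at *
          linarith
      _ ≤ s n + ‖w - z‖ * (d (n + 1) * s n * d (n + 1)) := by gcongr
      _ = _ := by ring
  set B := ∑' k, d k ^ 2 with hB
  have hbound : ∀ n, s n ≤ s 0 * Real.exp (‖w - z‖ * ∑ k ∈ Finset.range (n + 1), d k ^ 2) := by
    intro n
    induction n with
    | zero =>
      refine le_mul_of_one_le_right (hs0 0) (Real.one_le_exp ?_)
      exact mul_nonneg (norm_nonneg _) (Finset.sum_nonneg fun k _ => sq_nonneg _)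
    | succ n ih =>
      rw [Finset.sum_range_succ, mul_add, Real.exp_add, ← mul_assoc]
      refine (hstep n).trans ?_
      have h1 : 1 + ‖w - z‖ * d (n + 1) ^ 2 ≤ Real.exp (‖w - z‖ * d (n + 1) ^ 2) := by
        rw [add_comm]
        exact Real.add_one_le_exp _
      have h2 : 0 ≤ 1 + ‖w - z‖ * d (n + 1) ^ 2 := by positivity
      exact mul_le_mul ih h1 h2 (mul_nonneg (hs0 0) (Real.exp_pos _).le)
  set C := s 0 * Real.exp (‖w - z‖ * B) with hC
  have hC' : ∀ n, s n ≤ C := fun n => (hbound n).trans (by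
    refine mul_le_mul_of_nonneg_left (Real.exp_le_exp.2 ?_) (hs0 0)
    refine mul_le_mul_of_nonneg_left ?_ (norm_nonneg _)
    exact hdsum.sum_le_tsum _ fun k _ => sq_nonneg _)
  refine (summable_nat_add_iff 1).1 ?_
  refine Summable.of_nonneg_of_le (fun k => sq_nonneg _) (fun k => ?_)
    (((summable_nat_add_iff 1).2 hdsum).mul_left (C ^ 2))
  rw [← mul_pow]
  refine pow_le_pow_left₀ (norm_nonneg _) ((hu1 k).trans ?_) 2
  rw [mul_comm]
  exact mul_le_mul_of_nonneg_right (hC' k) (hd0 _)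

theorem memℓp_two_iff {f : ℕ → ℂ} : Memℓp f 2 ↔ Summable fun k => ‖f k‖ ^ 2 := by
  rw [memℓp_gen_iff (by norm_num)]
  simp

/-- If `J ≠ J*`, then all solutions are square summable. -/
theorem summable_of_not_isSelfAdjoint (h : ¬ IsSelfAdjoint A.op) {w a : ℂ} {u : ℕ → ℂ}
    (hu : ∀ k, A.diffExpr u k = w * u k + if k = 0 then a else 0) : Memℓp u 2 := by
  obtain ⟨z, hz, v, hv0, hv⟩ := A.exists_eigenvector h
  have hvD : ∀ k, A.diffExpr (v : EllTwo) k = z * (v : EllTwo) k + if k = 0 then 0 else 0 := by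
    intro k
    rw [← adjoint_apply, hv]
    simp
  -- The eigenvector is a multiple of P(z), so P(z) is square summable; subtracting tP(z) from the
  -- Weyl solution gives the same for Q(z).
  have hvP := A.eq_polyP_add_polyQ hvD
  simp only [zero_mul, add_zero] at hvP
  have hv00 : (v : EllTwo) 0 ≠ 0 := by
    intro h0
    refine hv0 ?_
    ext k
    rw [hvP, h0]
    simp
  have hP : Summable fun k => ‖A.polyP z k‖ ^ 2 := by
    have hs := memℓp_two_iff.1 (lp.memℓp (v : EllTwo))
    rw [hvP] at hs
    simp only [norm_mul, mul_pow] at hs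
    exact (summable_mul_left_iff (pow_ne_zero 2 (norm_ne_zero_iff.2 hv00))).1 hs
  obtain ⟨t, ht⟩ := A.exists_summable_weyl hz
  have hQ : Summable fun k => ‖A.polyQ z k‖ ^ 2 := by
    refine Summable.of_nonneg_of_le (fun k => sq_nonneg _) (fun k => ?_)
      ((ht.add (hP.mul_left (‖t‖ ^ 2))).mul_left 2)
    have h1 : ‖A.polyQ z k‖ ≤ ‖t * A.polyP z k + A.polyQ z k‖ + ‖t‖ * ‖A.polyP z k‖ := by
      rw [← norm_mul]
      calc ‖A.polyQ z k‖ = ‖(t * A.polyP z k + A.polyQ z k) - t * A.polyP z k‖ := by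
            congr 1; ring
        _ ≤ _ := norm_sub_le _ _
    rw [← mul_pow]
    nlinarith [norm_nonneg (A.polyQ z k), sq_nonneg (‖t * A.polyP z k + A.polyQ z k‖ -
      ‖t‖ * ‖A.polyP z k‖)]
  exact memℓp_two_iff.2 (A.summable_of_summable hP hQ hu)

end JacobiMatrix

/-! ### Boundary conditions at infinity and the operators J_h(g) -/

/-- A symmetric operator that acts by the difference expression and whose domain contains the
canonical basis. -/
structure IsJacobiExtension (A : JacobiMatrix) (T : EllTwo →ₗ.[ℂ] EllTwo) : Prop where
  symm : T.IsFormalAdjoint T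
  basis_mem : ∀ k, basisVec k ∈ T.domain
  apply_eq : ∀ (x : T.domain) (k : ℕ), T x k = A.diffExpr (x : EllTwo) k

namespace JacobiMatrix

variable (A : JacobiMatrix)

/-- The matrix with `q₁` replaced by `q₁ - h`. -/
def shift (h : ℝ) : JacobiMatrix where
  q k := if k = 0 then A.q 0 - h else A.q k
  b := A.b
  b_pos := A.b_pos

theorem shift_diffExpr (h : ℝ) (f : ℕ → ℂ) (k : ℕ) :
    (A.shift h).diffExpr f k = A.diffExpr f k - if k = 0 then h * f 0 else 0 := by
  cases k with
  | zero => simp [diffExpr, shift]; ring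
  | succ k => simp [diffExpr, shift]

theorem shift_injective {A A' : JacobiMatrix} {h : ℝ} (hA : A.shift h = A'.shift h) : A = A' := by
  have hq := congrArg JacobiMatrix.q hA
  have hb := congrArg JacobiMatrix.b hA
  refine JacobiMatrix.ext (funext fun k => ?_) hb
  have := congrFun hq k
  simp only [shift] at this
  split_ifs at this with hk
  · subst hk
    linarith
  · exact this

/-- A real solution at the point `0` that complements the boundary sequence. -/
def coBoundarySeq : WithTop ℝ → ℕ → ℂ
  | (_ : ℝ) => A.polyQ 0
  | ⊤ => fun k => -A.polyP 0 k

theorem diffExpr_coBoundarySeq (g : WithTop ℝ) :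
    ∃ a : ℂ, ∀ k, A.diffExpr (A.coBoundarySeq g) k =
      0 * A.coBoundarySeq g k + if k = 0 then a else 0 := by
  cases g with
  | coe g => exact ⟨1, fun k => A.diffExpr_polyQ 0 k⟩
  | top =>
    refine ⟨0, fun k => ?_⟩
    have := A.diffExpr_linear (-1) 0 (A.polyP 0) (A.polyQ 0) k
    simp only [neg_mul, one_mul, zero_mul, add_zero] at this
    refine this.trans ?_
    rw [diffExpr_polyP]
    simp

/-- The minus sign in `coBoundarySeq` at ⊤ serves this normalization: W(Q, -P) = W(P, Q) = 1. -/
theorem wronskian_boundarySeq (g : WithTop ℝ) (n : ℕ) :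
    A.wronskian (A.boundarySeq g) (A.coBoundarySeq g) n = 1 := by
  have h := A.wronskian_polyP_polyQ 0 n
  rw [← h]
  cases g <;> simp only [boundarySeq, coBoundarySeq, wronskian] <;> ring

theorem boundarySeq_conj (g : WithTop ℝ) :
    (fun j => (starRingEnd ℂ) (A.boundarySeq g j)) = A.boundarySeq g := by
  have hP := A.polyP_conj 0
  have hQ := A.polyQ_conj 0
  rw [map_zero] at hP hQ
  cases g with
  | top => exact hQ
  | coe g =>
    funext j
    simp only [boundarySeq, map_add, map_mul, Complex.conj_ofReal]
    rw [congrFun hP j, congrFun hQ j]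

theorem coBoundarySeq_conj (g : WithTop ℝ) :
    (fun j => (starRingEnd ℂ) (A.coBoundarySeq g j)) = A.coBoundarySeq g := by
  have hP := A.polyP_conj 0
  have hQ := A.polyQ_conj 0
  rw [map_zero] at hP hQ
  cases g with
  | coe g => exact hQ
  | top =>
    funext j
    simp only [coBoundarySeq, map_neg]
    rw [congrFun hP j]

/-- The Wronskian of a square summable solution and of an element of the domain of `J*`
converges. -/
theorem exists_tendsto_wronskian {u : ℕ → ℂ} (hu2 : Memℓp u 2) {w a : ℂ}
    (hu : ∀ k, A.diffExpr u k = w * u k + if k = 0 then a else 0) {f F : EllTwo}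
    (hf : ∀ k, A.diffExpr f k = F k) :
    ∃ l, Tendsto (A.wronskian (fun j => (starRingEnd ℂ) (u j)) f) atTop (𝓝 l) := by
  refine ⟨_, A.tendsto_wronskian (u := ⟨u, hu2⟩) (U := w • ⟨u, hu2⟩ + a • basisVec 0)
    (fun k => ?_) hf⟩
  refine (hu k).trans ?_
  have : (w • (⟨u, hu2⟩ : EllTwo) + a • basisVec 0) k = w * u k + a * basisVec 0 k := rfl
  rw [this, basisVec_apply]
  split_ifs <;> simp

/-- Plücker relation with v(g) and its complement, whose Wronskian is 1. Each product has a factor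
tending to 0 by the boundary condition; the other factor converges because the complement is square
summable when J ≠ J*. This is the symmetry of J(g). -/
theorem wronskian_tendsto_zero_of_boundary (h : ¬ IsSelfAdjoint A.op) {g : WithTop ℝ}
    {x y X Y : EllTwo} (hx : ∀ k, A.diffExpr x k = X k) (hy : ∀ k, A.diffExpr y k = Y k)
    (hx0 : Tendsto (A.wronskian (A.boundarySeq g) x) atTop (𝓝 0))
    (hy0 : Tendsto (A.wronskian (A.boundarySeq g) y) atTop (𝓝 0)) :
    Tendsto (A.wronskian (fun j => (starRingEnd ℂ) (x j)) y) atTop (𝓝 0) := by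
  obtain ⟨a, ha⟩ := A.diffExpr_coBoundarySeq g
  have hc2 := A.summable_of_not_isSelfAdjoint h ha
  obtain ⟨lx, hlx⟩ := A.exists_tendsto_wronskian hc2 ha hx
  obtain ⟨ly, hly⟩ := A.exists_tendsto_wronskian hc2 ha hy
  rw [coBoundarySeq_conj] at hlx hly
  have hx0' : Tendsto (fun n => (starRingEnd ℂ) (A.wronskian (A.boundarySeq g) x n)) atTop
      (𝓝 0) := by
    have := (Complex.continuous_conj.tendsto _).comp hx0
    rwa [map_zero] at this
  have hlx' := (Complex.continuous_conj.tendsto _).comp hlx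
  have key := (hx0'.mul hly).sub (hlx'.mul hy0)
  rw [zero_mul, mul_zero, sub_zero] at key
  refine key.congr fun n => ?_
  rw [Function.comp_apply, ← wronskian_conj, ← wronskian_conj, boundarySeq_conj,
    coBoundarySeq_conj, ← wronskian_mul_wronskian, wronskian_boundarySeq, mul_one]

theorem opAt_apply (g : WithTop ℝ) (x : (A.opAt g).domain) :
    ∃ hx : (x : EllTwo) ∈ A.op.adjoint.domain, A.opAt g x = A.op.adjoint ⟨x, hx⟩ := by
  have hle : A.opAt g ≤ A.op.adjoint := by
    unfold opAt
    split_ifs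
    · exact A.op_le_adjoint
    · exact LinearPMap.domRestrict_le
  exact ⟨hle.1 x.2, hle.2 rfl⟩

theorem mem_opAt_domain (h : ¬ IsSelfAdjoint A.op) {g : WithTop ℝ} {x : EllTwo} :
    x ∈ (A.opAt g).domain ↔ x ∈ A.op.adjoint.domain ∧
      Tendsto (A.wronskian (A.boundarySeq g) x) atTop (𝓝 0) := by
  rw [opAt, if_neg h, LinearPMap.domRestrict_domain]
  exact ⟨fun hx => hx.1, fun hx => ⟨hx, hx.1⟩⟩

theorem isJacobiExtension_opAt (g : WithTop ℝ) : IsJacobiExtension A (A.opAt g) where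
  symm := by
    by_cases h : IsSelfAdjoint A.op
    · rw [opAt, if_pos h]
      exact A.op_symm
    · intro x y
      obtain ⟨hx, hxe⟩ := A.opAt_apply g x
      obtain ⟨hy, hye⟩ := A.opAt_apply g y
      have hxD := A.adjoint_apply ⟨x, hx⟩
      have hyD := A.adjoint_apply ⟨y, hy⟩
      rw [← hxe] at hxD
      rw [← hye] at hyD
      have h0 := A.wronskian_tendsto_zero_of_boundary h (fun k => (hxD k).symm)
        (fun k => (hyD k).symm) ((A.mem_opAt_domain h).1 x.2).2 ((A.mem_opAt_domain h).1 y.2).2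
      have h1 := A.tendsto_wronskian (fun k => (hxD k).symm) (fun k => (hyD k).symm)
      exact (sub_eq_zero.1 (tendsto_nhds_unique h1 h0)).symm
  basis_mem k := by
    by_cases h : IsSelfAdjoint A.op
    · rw [opAt, if_pos h]
      exact A.basisVec_mem_op k
    · rw [mem_opAt_domain A h]
      refine ⟨A.op_le_adjoint.1 (A.basisVec_mem_op k), tendsto_const_nhds.congr' ?_⟩
      filter_upwards [eventually_gt_atTop k] with n hn
      have h1 : n ≠ k := by omega
      have h2 : n + 1 ≠ k := by omega
      simp [wronskian, basisVec_apply, h1, h2]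
  apply_eq x k := by
    obtain ⟨hx, hxe⟩ := A.opAt_apply g x
    rw [hxe, adjoint_apply]

theorem perturbedOp_apply (h : ℝ) (g : WithTop ℝ) (x : (A.opAt g).domain) :
    A.perturbedOp h g x = A.opAt g x -
      ((h : ℂ) * inner ℂ firstBasisVector (x : EllTwo)) • firstBasisVector := by
  rw [sub_eq_neg_add, mul_smul]
  rfl

/-- The perturbation changes only the corner entry, so J_h(g) is treated as an extension for the
shifted matrix. -/
theorem isJacobiExtension_perturbedOp (h : ℝ) (g : WithTop ℝ) :
    IsJacobiExtension (A.shift h) (A.perturbedOp h g) where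
  symm x y := by
    have hs := (A.isJacobiExtension_opAt g).symm x y
    erw [perturbedOp_apply, perturbedOp_apply, inner_sub_left, inner_sub_right, hs]
    rw [inner_smul_left, inner_smul_right, map_mul, Complex.conj_ofReal, inner_conj_symm]
    ring
  basis_mem := (A.isJacobiExtension_opAt g).basis_mem
  apply_eq x k := by
    have hs := (A.isJacobiExtension_opAt g).apply_eq x k
    rw [shift_diffExpr, ← hs]
    erw [perturbedOp_apply]
    rw [← basisVec_zero, inner_basisVec_left, lp.coeFn_sub, Pi.sub_apply, lp.coeFn_smul,
      Pi.smul_apply, basisVec_apply]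
    split_ifs <;> simp

theorem isRankOnePerturbation_perturbedOp (h₁ h₂ : ℝ) (g : WithTop ℝ) :
    IsRankOnePerturbation (h₂ - h₁) (A.perturbedOp h₁ g) (A.perturbedOp h₂ g) where
  domain_eq := rfl
  apply_eq x hx₁ hx₂ := by
    have e₁ := A.perturbedOp_apply h₁ g ⟨x, hx₁⟩
    have e₂ := A.perturbedOp_apply h₂ g ⟨x, hx₂⟩
    refine (e₂.trans ?_).trans (congrArg (· - _) e₁.symm)
    simp only [Complex.ofReal_sub, sub_mul, sub_smul]
    abel

theorem isRankOnePerturbation_opAt (h : ℝ) (g : WithTop ℝ) :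
    IsRankOnePerturbation h (A.opAt g) (A.perturbedOp h g) where
  domain_eq := rfl
  apply_eq x _ hx := A.perturbedOp_apply h g ⟨x, hx⟩

end JacobiMatrix

/-! ### From the Weyl function to the matrix -/

namespace IsJacobiExtension

variable {A A' : JacobiMatrix} {T T' : EllTwo →ₗ.[ℂ] EllTwo}

/-- The entries of `T eₖ`, for `k ≥ 1`. -/
theorem apply_basisVec_succ (h : IsJacobiExtension A T) (k : ℕ) :
    T ⟨basisVec (k + 1), h.basis_mem (k + 1)⟩ = (A.b k : ℂ) • basisVec k +
      (A.q (k + 1) : ℂ) • basisVec (k + 1) + (A.b (k + 1) : ℂ) • basisVec (k + 2) := by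
  ext j
  rw [h.apply_eq]
  simp only [lp.coeFn_add, Pi.add_apply, lp.coeFn_smul, Pi.smul_apply, smul_eq_mul]
  cases j with
  | zero => simp [JacobiMatrix.diffExpr, basisVec_apply]; grind
  | succ j => simp [JacobiMatrix.diffExpr, basisVec_apply]; grind

theorem apply_basisVec_zero (h : IsJacobiExtension A T) :
    T ⟨basisVec 0, h.basis_mem 0⟩ = (A.q 0 : ℂ) • basisVec 0 + (A.b 0 : ℂ) • basisVec 1 := by
  ext j
  rw [h.apply_eq]
  simp only [lp.coeFn_add, Pi.add_apply, lp.coeFn_smul, Pi.smul_apply, smul_eq_mul]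
  cases j with
  | zero => simp [JacobiMatrix.diffExpr, basisVec_apply]
  | succ j => simp [JacobiMatrix.diffExpr, basisVec_apply]; grind

/-- As b_k ≠ 0, Te_k reaches e_{k+1}: by induction the closed kernel contains the whole basis. -/
theorem firstVectorCyclic (h : IsJacobiExtension A T) : FirstVectorCyclic T := by
  intro S hS hinv
  have key : ∀ k, S (basisVec k) = 0 ∧ S (basisVec (k + 1)) = 0 := by
    intro k
    induction k with
    | zero =>
      have h0 : S (basisVec 0) = 0 := hS
      refine ⟨h0, ?_⟩
      have := hinv ⟨basisVec 0, h.basis_mem 0⟩ h0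
      rw [h.apply_basisVec_zero, map_add, map_smul, map_smul, h0, smul_zero, zero_add] at this
      exact (smul_eq_zero.1 this).resolve_left (A.b_ne_zero 0)
    | succ k ih =>
      refine ⟨ih.2, ?_⟩
      have := hinv ⟨basisVec (k + 1), h.basis_mem _⟩ ih.2
      rw [h.apply_basisVec_succ, map_add, map_add, map_smul, map_smul, map_smul, ih.1, ih.2,
        smul_zero, smul_zero, zero_add, zero_add] at this
      exact (smul_eq_zero.1 this).resolve_left (A.b_ne_zero (k + 1))
  have hd : Dense ((LinearMap.ker S.toLinearMap : Submodule ℂ EllTwo) : Set EllTwo) :=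
    dense_of_basisVec_mem fun k => (key k).1
  ext1 x
  have hcl : IsClosed ((LinearMap.ker S.toLinearMap : Submodule ℂ EllTwo) : Set EllTwo) :=
    S.isClosed_ker
  have : x ∈ ((LinearMap.ker S.toLinearMap : Submodule ℂ EllTwo) : Set EllTwo) := by
    rw [← hcl.closure_eq]
    exact hd x
  exact this

theorem diffExpr_resolv (h : IsJacobiExtension A T) {z : ℂ} (hz : z ∉ opSpectrum T) (y : EllTwo)
    (k : ℕ) : A.diffExpr (resolv T z y) k = y k + z * resolv T z y k := by
  have := h.apply_eq ⟨resolv T z y, resolv_mem hz y⟩ k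
  rw [apply_resolv hz] at this
  exact this.symm

theorem weylFun_eq {z : ℂ} : weylFun T z = resolv T z (basisVec 0) 0 := by
  rw [weylFun, ← basisVec_zero, inner_basisVec_left]

end IsJacobiExtension

namespace IsJacobiExtension

variable {A A' : JacobiMatrix} {T T' : EllTwo →ₗ.[ℂ] EllTwo}

theorem apply_basisVec_mem (h : IsJacobiExtension A T) (k : ℕ) :
    T ⟨basisVec k, h.basis_mem k⟩ ∈ T.domain := by
  cases k with
  | zero =>
    rw [h.apply_basisVec_zero]
    exact T.domain.add_mem (T.domain.smul_mem _ (h.basis_mem _))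
      (T.domain.smul_mem _ (h.basis_mem _))
  | succ k =>
    rw [h.apply_basisVec_succ]
    exact T.domain.add_mem (T.domain.add_mem (T.domain.smul_mem _ (h.basis_mem _))
      (T.domain.smul_mem _ (h.basis_mem _))) (T.domain.smul_mem _ (h.basis_mem _))

theorem inner_basisVec_apply (h : IsJacobiExtension A T) (k : ℕ) :
    inner ℂ (basisVec k) (T ⟨basisVec k, h.basis_mem k⟩) = (A.q k : ℂ) := by
  rw [inner_basisVec_left, h.apply_eq]
  cases k <;> simp [JacobiMatrix.diffExpr, basisVec_apply]

theorem inner_apply_apply (h : IsJacobiExtension A T) (k : ℕ) :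
    inner ℂ (T ⟨basisVec k, h.basis_mem k⟩) (T ⟨basisVec k, h.basis_mem k⟩) =
      (((if k = 0 then 0 else A.b (k - 1) ^ 2) + A.q k ^ 2 + A.b k ^ 2 : ℝ) : ℂ) := by
  have e := h.symm ⟨basisVec k, h.basis_mem k⟩ ⟨_, h.apply_basisVec_mem k⟩
  rw [e, inner_basisVec_left, h.apply_eq]
  cases k with
  | zero =>
    simp only [JacobiMatrix.diffExpr, h.apply_eq]
    simp [basisVec_apply]
    ring
  | succ k =>
    simp only [JacobiMatrix.diffExpr, h.apply_eq]
    cases k with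
    | zero =>
      simp [basisVec_apply]
      ring
    | succ n =>
      have h2 : n ≠ n + 1 + 1 := by omega
      simp [basisVec_apply, h2]
      ring

/-- The first three terms of the expansion of a diagonal entry of the resolvent at infinity. -/
theorem tendsto_diag (h : IsJacobiExtension A T) (hn : ∀ z : ℂ, z.im ≠ 0 → z ∉ opSpectrum T)
    (k : ℕ) :
    Tendsto (fun y : ℝ => (y * Complex.I) *
      (1 + (y * Complex.I) * resolv T (y * Complex.I) (basisVec k) k)) atTop (𝓝 (-A.q k)) ∧
    Tendsto (fun y : ℝ => (y * Complex.I) * (A.q k + (y * Complex.I) *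
      (1 + (y * Complex.I) * resolv T (y * Complex.I) (basisVec k) k))) atTop
      (𝓝 (-(((if k = 0 then 0 else A.b (k - 1) ^ 2) + A.q k ^ 2 + A.b k ^ 2 : ℝ) : ℂ))) := by
  -- zR(z)Te_k → -Te_k along the imaginary axis. Pairing with e_k produces q_k, pairing with Te_k
  -- produces ‖Te_k‖².
  have ht := tendsto_smul_resolv h.symm hn (h.apply_basisVec_mem k)
  have hin : ∀ x : EllTwo, Tendsto (fun y : ℝ => (y * Complex.I) * (inner ℂ x
      (resolv T (y * Complex.I) (T ⟨basisVec k, h.basis_mem k⟩)) : ℂ)) atTop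
      (𝓝 (-inner ℂ x (T ⟨basisVec k, h.basis_mem k⟩))) := by
    intro x
    have := ((innerSL ℂ x).continuous.tendsto _).comp ht
    rw [innerSL_apply_apply, inner_neg_right] at this
    refine this.congr fun y => ?_
    rw [Function.comp_apply, innerSL_apply_apply, inner_smul_right]
  have hy : ∀ᶠ y : ℝ in atTop, ((y : ℂ) * Complex.I) ∉ opSpectrum T := by
    filter_upwards [eventually_gt_atTop 0] with y hy
    exact hn _ (by simpa using hy.ne')
  constructor
  · have := hin (basisVec k)
    rw [h.inner_basisVec_apply] at this
    refine this.congr' ?_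
    filter_upwards [hy] with y hy
    rw [resolv_apply hy, inner_add_right, inner_smul_right, inner_basisVec_left,
      inner_basisVec_left, basisVec_apply, if_pos rfl]
  · have := hin (T ⟨basisVec k, h.basis_mem k⟩)
    rw [h.inner_apply_apply] at this
    refine this.congr' ?_
    filter_upwards [hy] with y hy
    have e₁ : inner ℂ (T ⟨basisVec k, h.basis_mem k⟩) (basisVec k) = (A.q k : ℂ) := by
      rw [← inner_conj_symm, h.inner_basisVec_apply, Complex.conj_ofReal]
    have e₂ := h.symm ⟨basisVec k, h.basis_mem k⟩ ⟨_, resolv_mem hy (basisVec k)⟩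
    simp only at e₂
    rw [resolv_apply hy, inner_add_right, inner_smul_right, e₁, e₂, apply_resolv hy,
      inner_add_right, inner_smul_right, inner_basisVec_left, inner_basisVec_left, basisVec_apply,
      if_pos rfl]

/-- The Weyl function determines the matrix. -/
theorem matrix_eq_of_weylFun_eq (h : IsJacobiExtension A T) (h' : IsJacobiExtension A' T')
    (hn : ∀ z : ℂ, z.im ≠ 0 → z ∉ opSpectrum T) (hn' : ∀ z : ℂ, z.im ≠ 0 → z ∉ opSpectrum T')
    (hm : ∀ z : ℂ, z.im ≠ 0 → weylFun T z = weylFun T' z) : A = A' := by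
  -- Known at stage k: the matrix entries of index below k and the resolvent block of indices up to
  -- k. The diagonal entry at k gives q_k, then b_k² since b_{k-1} is known; b_k > 0 fixes the root.
  have key : ∀ k, (∀ j < k, A.q j = A'.q j ∧ A.b j = A'.b j) ∧
      ∀ z : ℂ, z.im ≠ 0 → ∀ j ≤ k, ∀ l ≤ k,
        resolv T z (basisVec j) l = resolv T' z (basisVec j) l := by
    intro k
    induction k with
    | zero =>
      refine ⟨fun j hj => absurd hj (Nat.not_lt_zero j), fun z hz j hj l hl => ?_⟩
      obtain rfl := Nat.le_zero.1 hj
      obtain rfl := Nat.le_zero.1 hl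
      have := hm z hz
      rwa [weylFun_eq, weylFun_eq] at this
    | succ k ih =>
      obtain ⟨ihc, ihg⟩ := ih
      have hy : ∀ᶠ y : ℝ in atTop, ((y : ℂ) * Complex.I).im ≠ 0 := by
        filter_upwards [eventually_gt_atTop 0] with y hy
        simpa using hy.ne'
      have hq : A.q k = A'.q k := by
        have := tendsto_nhds_unique ((h.tendsto_diag hn k).1.congr' ?_) (h'.tendsto_diag hn' k).1
        · exact_mod_cast neg_injective this
        · filter_upwards [hy] with y hy
          rw [ihg _ hy k le_rfl k le_rfl]
      have hb : A.b k = A'.b k := by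
        have e := tendsto_nhds_unique ((h.tendsto_diag hn k).2.congr' ?_) (h'.tendsto_diag hn' k).2
        · have e₁ : ((if k = 0 then 0 else A.b (k - 1) ^ 2) + A.q k ^ 2 + A.b k ^ 2 : ℝ) =
              (if k = 0 then 0 else A'.b (k - 1) ^ 2) + A'.q k ^ 2 + A'.b k ^ 2 := by
            exact_mod_cast neg_injective e
          have e₂ : A.b k ^ 2 = A'.b k ^ 2 := by
            rw [hq] at e₁
            split_ifs at e₁ with hk
            · linarith
            · rw [(ihc (k - 1) (by omega)).2] at e₁
              linarith
          exact (pow_left_inj₀ (A.b_pos k).le (A'.b_pos k).le two_ne_zero).1 e₂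
        · filter_upwards [hy] with y hy
          rw [ihg _ hy k le_rfl k le_rfl, hq]
      have hc : ∀ j < k + 1, A.q j = A'.q j ∧ A.b j = A'.b j := by
        intro j hj
        rcases Nat.lt_succ_iff_lt_or_eq.1 hj with hj | rfl
        exacts [ihc j hj, ⟨hq, hb⟩]
      refine ⟨hc, fun z hz => ?_⟩
      have hbk := A'.b_ne_zero k
      -- R(z)(T - z)e_k = e_k expresses b_k R(z)e_{k+1} through known columns; afterwards (T -
      -- z)R(z)e_j = e_j, read at index k, gives the entry at k + 1.
      have hrow : ∀ j ≤ k + 1, ∀ l ≤ k,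
          resolv T z (basisVec j) l = resolv T' z (basisVec j) l := by
        intro j hj l hl
        rcases Nat.le_succ_iff.1 hj with hj | rfl
        · exact ihg z hz j hj l hl
        have e := congrArg (fun x : EllTwo => x l)
          (resolv_apply (hn z hz) ⟨basisVec k, h.basis_mem k⟩)
        have e' := congrArg (fun x : EllTwo => x l)
          (resolv_apply (hn' z hz) ⟨basisVec k, h'.basis_mem k⟩)
        have ek := ihg z hz k le_rfl l hl
        refine mul_left_cancel₀ hbk ?_
        cases k with
        | zero =>
          rw [h.apply_basisVec_zero] at e
          rw [h'.apply_basisVec_zero] at e'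
          simp only [map_add, map_smul, lp.coeFn_add, Pi.add_apply, lp.coeFn_smul, Pi.smul_apply,
            smul_eq_mul] at e e'
          rw [hq, hb, ek] at e
          linear_combination e - e'
        | succ k =>
          rw [h.apply_basisVec_succ] at e
          rw [h'.apply_basisVec_succ] at e'
          simp only [map_add, map_smul, lp.coeFn_add, Pi.add_apply, lp.coeFn_smul, Pi.smul_apply,
            smul_eq_mul] at e e'
          rw [hq, hb, ek, (ihc k (by omega)).2, ihg z hz k (by omega) l hl] at e
          linear_combination e - e'
      intro j hj l hl
      rcases Nat.le_succ_iff.1 hl with hl | rfl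
      · exact hrow j hj l hl
      have e := h.diffExpr_resolv (hn z hz) (basisVec j) k
      have e' := h'.diffExpr_resolv (hn' z hz) (basisVec j) k
      have ek := hrow j hj k le_rfl
      refine mul_left_cancel₀ hbk ?_
      cases k with
      | zero =>
        simp only [JacobiMatrix.diffExpr] at e e'
        rw [hq, hb, ek] at e
        linear_combination e - e'
      | succ k =>
        simp only [JacobiMatrix.diffExpr] at e e'
        rw [hq, hb, ek, (ihc k (by omega)).2, hrow j hj k (by omega)] at e
        linear_combination e - e'
  exact JacobiMatrix.ext (funext fun k => ((key (k + 1)).1 k k.lt_succ_self).1)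
    (funext fun k => ((key (k + 1)).1 k k.lt_succ_self).2)

/-- Both vectors solve the same recursion, and their entries at 0 are the Weyl functions. -/
theorem resolv_eq_of_weylFun_eq (h : IsJacobiExtension A T) (h' : IsJacobiExtension A T') {z : ℂ}
    (hz : z ∉ opSpectrum T) (hz' : z ∉ opSpectrum T') (hm : weylFun T z = weylFun T' z) :
    resolv T z (basisVec 0) = resolv T' z (basisVec 0) := by
  refine lp.ext (A.eq_of_diffExpr_sub_eq (z := z) (fun k => ?_) ?_)
  · rw [h.diffExpr_resolv hz, h'.diffExpr_resolv hz']
    ring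
  · rwa [weylFun_eq, weylFun_eq] at hm

end IsJacobiExtension

/-! ### Uniqueness of the boundary condition and the theorem -/

namespace JacobiMatrix

variable (A : JacobiMatrix)

/-- Distinct boundary conditions are not both satisfied by a Weyl solution. -/
theorem boundary_unique (hA : ¬ IsSelfAdjoint A.op) {g g' : WithTop ℝ} {z : ℂ} {f : EllTwo}
    {m : ℂ} (hf : ∀ k, A.diffExpr f k = z * f k + if k = 0 then m else 0) (hm : m ≠ 0)
    (h : Tendsto (A.wronskian (A.boundarySeq g) f) atTop (𝓝 0))
    (h' : Tendsto (A.wronskian (A.boundarySeq g') f) atTop (𝓝 0)) : g = g' := by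
  by_contra hne
  have hPQ : Tendsto (A.wronskian (A.polyP 0) f) atTop (𝓝 0) ∧
      Tendsto (A.wronskian (A.polyQ 0) f) atTop (𝓝 0) := by
    have hreal : ∀ (c : ℝ), Tendsto (A.wronskian (A.boundarySeq c) f) atTop (𝓝 0) →
        Tendsto (A.wronskian (A.polyQ 0) f) atTop (𝓝 0) →
        Tendsto (A.wronskian (A.polyP 0) f) atTop (𝓝 0) := by
      intro c h₁ h₂
      have := h₁.sub (h₂.const_mul (c : ℂ))
      rw [mul_zero, sub_zero] at this
      refine this.congr fun n => ?_
      simp only [wronskian, boundarySeq]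
      ring
    cases g with
    | top =>
      cases g' with
      | top => exact absurd rfl hne
      | coe c => exact ⟨hreal c h' h, h⟩
    | coe c =>
      cases g' with
      | top => exact ⟨hreal c h h', h'⟩
      | coe c' =>
        have hcc : (c : ℂ) - c' ≠ 0 := by
          rw [sub_ne_zero]
          rintro hcc
          exact hne (by rw [Complex.ofReal_injective hcc])
        have hQ : Tendsto (A.wronskian (A.polyQ 0) f) atTop (𝓝 0) := by
          have := (h.sub h').const_mul (((c : ℂ) - c')⁻¹)
          rw [sub_zero, mul_zero] at this
          refine this.congr fun n => ?_
          simp only [wronskian, boundarySeq]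
          field_simp
          ring
        exact ⟨hreal c h hQ, hQ⟩
  -- The conjugate point appears because `exists_tendsto_wronskian` conjugates its first sequence.
  have hP2 : Memℓp (A.polyP ((starRingEnd ℂ) z)) 2 :=
    A.summable_of_not_isSelfAdjoint hA (w := (starRingEnd ℂ) z) (a := 0)
      (fun k => by rw [diffExpr_polyP]; simp)
  have hbd : ∀ (u : ℕ → ℂ) (a : ℂ),
      (∀ k, A.diffExpr u k = 0 * u k + if k = 0 then a else 0) →
      ∃ l, Tendsto (A.wronskian (A.polyP z) u) atTop (𝓝 l) := by
    intro u a hu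
    have hu2 := A.summable_of_not_isSelfAdjoint hA hu
    obtain ⟨l, hl⟩ := A.exists_tendsto_wronskian hP2 (w := (starRingEnd ℂ) z) (a := 0)
      (fun k => by rw [diffExpr_polyP]; simp) (f := ⟨u, hu2⟩) (F := a • basisVec 0) (fun k => by
        refine (hu k).trans ?_
        rw [lp.coeFn_smul, Pi.smul_apply, basisVec_apply]
        split_ifs <;> simp)
    rw [polyP_conj, Complex.conj_conj] at hl
    exact ⟨l, hl⟩
  obtain ⟨l₁, hl₁⟩ := hbd (A.polyP 0) 0 (fun k => by rw [diffExpr_polyP]; simp)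
  obtain ⟨l₂, hl₂⟩ := hbd (A.polyQ 0) 1 (fun k => A.diffExpr_polyQ 0 k)
  have hlim := (hl₂.mul hPQ.1).sub (hl₁.mul hPQ.2)
  rw [mul_zero, mul_zero, sub_zero] at hlim
  -- By the Plücker relation the left side is W(P(z), f), constantly equal to the source m. Both of
  -- its terms tend to 0, so m = 0, a contradiction.
  have hone : ∀ n, A.wronskian (A.polyP z) (A.polyQ 0) n * A.wronskian (A.polyP 0) f n -
      A.wronskian (A.polyP z) (A.polyP 0) n * A.wronskian (A.polyQ 0) f n = m := by
    intro n
    have h1 := A.wronskian_mul_wronskian (A.polyP z) f (A.polyP 0) (A.polyQ 0) n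
    rw [wronskian_polyP_polyQ, mul_one] at h1
    have h2 : A.wronskian (A.polyP z) f n = m := by
      rw [← sum_eq_wronskian, Finset.sum_eq_single 0]
      · rw [hf, diffExpr_polyP, polyP, if_pos rfl]
        ring
      · intro k _ hk
        rw [hf, diffExpr_polyP, if_neg hk]
        ring
      · simp
    rw [← h2, h1]
    simp only [wronskian]
    ring
  simp only [hone] at hlim
  exact hm (tendsto_nhds_unique tendsto_const_nhds hlim)

theorem isRealDiscrete_opAt {g : WithTop ℝ} (hdisc : HasDiscreteSpectrum (A.opAt g)) :
    IsRealDiscrete (A.opAt g) where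
  symm := (A.isJacobiExtension_opAt g).symm
  cyclic := (A.isJacobiExtension_opAt g).firstVectorCyclic
  first_mem := (A.isJacobiExtension_opAt g).basis_mem 0
  nonreal z hz hmem := by
    have hT := (A.isJacobiExtension_opAt g).symm
    refine (hdisc.2 z hmem).1 ((Submodule.eq_bot_iff _).2 fun x hx => ?_)
    have hx : A.opAt g x = z • (x : EllTwo) := by
      have : (A.opAt g).toFun x - z • (x : EllTwo) = 0 := hx
      exact sub_eq_zero.1 this
    have him := hT.im_inner x
    rw [hx, inner_smul_right, inner_self_eq_norm_sq_to_K] at him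
    have e : (z * ((‖(x : EllTwo)‖ : ℝ) : ℂ) ^ 2).im = z.im * ‖(x : EllTwo)‖ ^ 2 := by
      rw [← Complex.ofReal_pow, Complex.im_mul_ofReal]
    have h0 := (mul_eq_zero.1 (e.symm.trans him)).resolve_left hz
    exact Subtype.ext (norm_eq_zero.1 (pow_eq_zero_iff two_ne_zero |>.1 h0))
  isolated w := by
    have := hdisc.1 w
    rw [accPt_iff_frequently_nhdsNE, not_frequently] at this
    exact this

theorem isRealDiscrete_perturbedOp {g : WithTop ℝ} (hdisc : HasDiscreteSpectrum (A.opAt g))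
    (h : ℝ) : IsRealDiscrete (A.perturbedOp h g) :=
  (A.isRealDiscrete_opAt hdisc).perturbation (A.isRankOnePerturbation_opAt h g)
    (A.isJacobiExtension_perturbedOp h g).symm
    (A.isJacobiExtension_perturbedOp h g).firstVectorCyclic

/-- The Weyl function of a perturbed operator determines the matrix and the boundary condition. -/
theorem eq_of_weylFun_perturbedOp_eq {A A' : JacobiMatrix} {g g' : WithTop ℝ} {h : ℝ}
    (hn : ∀ z : ℂ, z.im ≠ 0 → z ∉ opSpectrum (A.perturbedOp h g))
    (hn' : ∀ z : ℂ, z.im ≠ 0 → z ∉ opSpectrum (A'.perturbedOp h g'))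
    (hm : ∀ z : ℂ, z.im ≠ 0 → weylFun (A.perturbedOp h g) z = weylFun (A'.perturbedOp h g') z) :
    A = A' ∧ (¬ IsSelfAdjoint A.op → g = g') := by
  have hAA : A = A' := shift_injective ((A.isJacobiExtension_perturbedOp h
    g).matrix_eq_of_weylFun_eq (A'.isJacobiExtension_perturbedOp h g') hn hn' hm)
  subst hAA
  refine ⟨rfl, fun hA => ?_⟩
  have hI : Complex.I.im ≠ 0 := by simp
  have E := A.isJacobiExtension_perturbedOp h g
  have hR := E.resolv_eq_of_weylFun_eq (A.isJacobiExtension_perturbedOp h g') (hn _ hI) (hn' _ hI)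
    (hm _ hI)
  set f := resolv (A.perturbedOp h g) Complex.I (basisVec 0) with hf
  have m₁ : f ∈ (A.opAt g).domain := resolv_mem (hn _ hI) _
  have m₂ : f ∈ (A.opAt g').domain := by
    rw [hR]
    exact resolv_mem (hn' _ hI) _
  -- Moving the corner term -h f₀ of the shifted matrix to the right side turns the source 1 into 1
  -- + h f₀.
  have hD : ∀ k, A.diffExpr f k =
      Complex.I * f k + if k = 0 then 1 + (h : ℂ) * f 0 else 0 := by
    intro k
    have e := E.diffExpr_resolv (hn _ hI) (basisVec 0) k
    rw [shift_diffExpr, basisVec_apply, ← hf] at e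
    split_ifs at e ⊢ <;> linear_combination e
  -- Here f 0 is the Weyl function at i, which is not real; so 1 + h f₀ is nonreal or, for h = 0,
  -- equal to 1.
  have hne : 1 + (h : ℂ) * f 0 ≠ 0 := by
    intro h0
    have him : (f 0).im ≠ 0 := by
      have := im_weylFun E.symm (hn _ hI)
      rw [IsJacobiExtension.weylFun_eq, ← hf] at this
      rw [this]
      exact mul_ne_zero hI (pow_ne_zero 2 (norm_ne_zero_iff.2
        (resolv_firstBasisVector_ne_zero (hn _ hI))))
    have h1 := congrArg Complex.im h0
    simp only [Complex.add_im, Complex.one_im, zero_add, Complex.im_ofReal_mul,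
      Complex.zero_im, mul_eq_zero, him, or_false] at h1
    simp [h1] at h0
  exact A.boundary_unique hA hD hne ((A.mem_opAt_domain hA).1 m₁).2 ((A.mem_opAt_domain hA).1 m₂).2

end JacobiMatrix


theorem mainTheorem1 (A A' : JacobiMatrix) (g g' : WithTop ℝ) (h₁ h₂ h₁' h₂' : ℝ)
    (hne : h₁ ≠ h₂) (hdisc : HasDiscreteSpectrum (A.opAt g))
    (hspec₁ : opSpectrum (A.perturbedOp h₁ g) = opSpectrum (A'.perturbedOp h₁' g'))
    (hspec₂ : opSpectrum (A.perturbedOp h₂ g) = opSpectrum (A'.perturbedOp h₂' g')) :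
    (h₁ = h₁' → A = A' ∧ h₂ = h₂' ∧ (¬ IsSelfAdjoint A.op → g = g')) ∧
    (h₂ = h₂' → A = A' ∧ h₁ = h₁' ∧ (¬ IsSelfAdjoint A.op → g = g')) := by
  have hT := A.isRealDiscrete_perturbedOp hdisc
  -- Nothing is assumed about the spectrum of J'(g'); the required properties pass over through the
  -- equality of spectra.
  have hT' : ∀ {k k' : ℝ}, opSpectrum (A.perturbedOp k g) = opSpectrum (A'.perturbedOp k' g') →
      IsRealDiscrete (A'.perturbedOp k' g') := fun {k k'} hs =>
    have E := A'.isJacobiExtension_perturbedOp k' g'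
    (hT k).congr_spectrum hs E.symm E.firstVectorCyclic (E.basis_mem 0)
  have main : ∀ {k l k' l' : ℝ}, k ≠ l →
      opSpectrum (A.perturbedOp k g) = opSpectrum (A'.perturbedOp k' g') →
      opSpectrum (A.perturbedOp l g) = opSpectrum (A'.perturbedOp l' g') →
      l = l' → A = A' ∧ k = k' ∧ (¬ IsSelfAdjoint A.op → g = g') := by
    rintro k l k' l hkl hs₁ hs₂ rfl
    obtain ⟨hc, hm⟩ := (hT k).weylFun_eq_of_opSpectrum_eq (hT l) (hT' hs₁) (hT' hs₂)
      (A.isRankOnePerturbation_perturbedOp k l g) (A'.isRankOnePerturbation_perturbedOp k' l g')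
      (sub_ne_zero.2 hkl.symm) hs₁ hs₂
    obtain ⟨h, hg⟩ := JacobiMatrix.eq_of_weylFun_perturbedOp_eq (hT l).nonreal
      (hT' hs₂).nonreal hm
    exact ⟨h, sub_right_injective hc, hg⟩
  exact ⟨main hne.symm hspec₂ hspec₁, main hne hspec₁ hspec₂⟩

end
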